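/- Let $\tau$ lie in the upper half-plane and let $C=\mathbb C/(\mathbb Z+\mathbb Z\tau)$ be the complex torus with its sheaf $\mathcal O_C$ of holomorphic functions. Definitions. For a finite-dimensional complex vector space $V$, let $\mathrm{Quot}^{H^0}(\mathcal O_C\otimes V)$ be the complex manifold of quotients $\mathcal O_C\otimes V\to F\to 0$ with $F$ of finite length $\dim V$ for which $V=H^0(\mathcal O_C\otimes V)\to H^0(F)$ is surjective (hence bijective). Let $E$ be a smooth complex vector bundle over $S^1$ with sheaf of smooth sections $\mathcal E$. A morphism $\varphi:(S^{1,Az},\mathcal E)\to C$ is a smooth family of points $[\mathcal O_C\otimes E_x\to\widetilde{\mathcal E}_x\to 0]\in\mathrm{Quot}^{H^0}(\mathcal O_C\otimes E_x)$, $x\in S^1$ (equivalently, a $GL_r(\mathbb C)$-equivariant smooth map from the frame bundle of $E$ to $\mathrm{Quot}^{H^0}(\mathcal O_C^{\oplus r},r)$, $r=\mathrm{rank}\,E$), such that the set $\{(x,p):(\widetilde{\mathcal E}_x)_p\ne 0\}\subset S^1\times C$ is a finite disjoint union of embedded (not necessarily closed) smooth submanifolds. The $\widetilde{\mathcal E}_x$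 form a sheaf $\widetilde{\mathcal E}$ on $S^1\times C$, whose sections are the families of elements of the stalks $(\widetilde{\mathcal E}_x)_p$ that are locally images of finite sums $\sum_i h_i\otimes s_i$, with $h_i$ holomorphic on $C$ and $s_i$ a smooth section of $E$; the push-forward is $\varphi_*\mathcal E:=\mathrm{pr}_{2*}\widetilde{\mathcal E}$, a sheaf of $\mathcal O_C$-modules. The multiplicity function $l_\varphi(x,p)$ is the length of $(\widetilde{\mathcal E}_x)_p$; it is the cycle on $S^1\times C$ carried by the support of $\widetilde{\mathcal E}$ with its multiplicities. The image cycle $\mathrm{Im}\,\varphi$ is the push-forward to $C$ of this cycle, oriented through $S^1$: a current $T$ is the image cycle of $\varphi$ if there are finitely many curves $\gamma_i:[0,2\pi]\to C$ with absolutely continuous lifts to $\mathbb C$ such that $\#\{i:\gamma_i(t)=p\}=l_\varphi(e^{it},p)$ for all $t$ and $p$, and $T(\eta)=\sum_i\int_{\gamma_i}\eta$ for every smooth real 1-form $\eta$ on $C$. Lemma (amalgamation of morphisms). Let $E_1,E_2$ be smooth complex vector bundles over $S^1$ with sheaves of smooth sections $\mathcal E_1,\mathcal E_2$, and let $\varphi_i:(S^{1,Az},\mathcal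 E_i)\to C$, $i=1,2$, be morphisms. Then there is a morphism $\varphi_3:(S^{1,Az},\mathcal E_1\oplus\mathcal E_2)\to C$ such that (1) $\mathrm{Im}\,\varphi_3=\mathrm{Im}\,\varphi_1+\mathrm{Im}\,\varphi_2$ as cycles, counted with multiplicity: $l_{\varphi_3}=l_{\varphi_1}+l_{\varphi_2}$ on $S^1\times C$, and if the currents $T_1,T_2$ are the image cycles on $C$ of $\varphi_1,\varphi_2$, then $T_1+T_2$ is the image cycle of $\varphi_3$; (2) $\varphi_{3*}(\mathcal E_1\oplus\mathcal E_2)\cong\varphi_{1*}\mathcal E_1\oplus\varphi_{2*}\mathcal E_2$ as sheaves of $\mathcal O_C$-modules on $C$. -/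

import Mathlib

open scoped Manifold ContDiff Bundle TensorProduct Topology
open TopologicalSpace

noncomputable section

namespace AzumayaCircle

/-! ### The complex torus and its sheaf of holomorphic functions -/

/-- The lattice `ℤ + ℤ τ`. -/
def lattice (τ : UpperHalfPlane) : AddSubgroup ℂ := AddSubgroup.closure {1, (τ : ℂ)}

/-- The complex torus `C = ℂ / (ℤ + ℤ τ)`, with the quotient topology. -/
abbrev Torus (τ : UpperHalfPlane) : Type := ℂ ⧸ lattice τ

/-- The covering projection `ℂ → C`, which is a local biholomorphism. -/
abbrev proj (τ : UpperHalfPlane) (z : ℂ) : Torus τ := QuotientAddGroup.mk z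

variable {τ : UpperHalfPlane}

/-- Germs of complex functions form a `ℂ`-algebra. -/
instance germAlgebra {α : Type*} (l : Filter α) : Algebra ℂ (Filter.Germ l ℂ) :=
  Algebra.ofModule
    (fun c f g => Filter.Germ.inductionOn₂ f g fun _ _ =>
      Filter.Germ.coe_eq.2 (Filter.Eventually.of_forall fun _ => smul_mul_assoc c _ _))
    (fun c f g => Filter.Germ.inductionOn₂ f g fun _ _ =>
      Filter.Germ.coe_eq.2 (Filter.Eventually.of_forall fun _ => mul_smul_comm c _ _))

/-- The germs at `p` of functions which are holomorphic near `p`, i.e. whose composition with the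
covering projection is analytic at the points over `p`. -/
def holoGerms (p : Torus τ) : Subalgebra ℂ (Filter.Germ (𝓝 p) ℂ) where
  carrier := {g | ∃ h : Torus τ → ℂ, (h : Filter.Germ (𝓝 p) ℂ) = g ∧
    ∀ z : ℂ, proj τ z = p → AnalyticAt ℂ (fun w => h (proj τ w)) z}
  mul_mem' := by
    rintro _ _ ⟨f, rfl, hf⟩ ⟨g, rfl, hg⟩
    exact ⟨f * g, rfl, fun z hz => (hf z hz).mul (hg z hz)⟩
  add_mem' := by
    rintro _ _ ⟨f, rfl, hf⟩ ⟨g, rfl, hg⟩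
    exact ⟨f + g, rfl, fun z hz => (hf z hz).add (hg z hz)⟩
  algebraMap_mem' c := ⟨fun _ => c,
    Filter.Germ.coe_eq.2 (Filter.Eventually.of_forall fun _ => (mul_one c).symm),
    fun _ _ => analyticAt_const⟩

/-- The local ring `𝒪_{C,p}`. -/
def LocalRing (p : Torus τ) : Type := holoGerms p

instance (p : Torus τ) : CommRing (LocalRing p) := inferInstanceAs (CommRing (holoGerms p))

instance (p : Torus τ) : Algebra ℂ (LocalRing p) := inferInstanceAs (Algebra ℂ (holoGerms p))

open Classical in
/-- The germ at `p ∈ U` of a function on the open set `U`. -/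
def rawGerm (U : Opens (Torus τ)) (p : Torus τ) (hp : p ∈ U) :
    (U → ℂ) →ₐ[ℂ] Filter.Germ (𝓝 p) ℂ where
  toFun f := ((fun q => if hq : q ∈ U then f ⟨q, hq⟩ else 0 : Torus τ → ℂ) :
    Filter.Germ (𝓝 p) ℂ)
  map_one' := by
    refine Filter.Germ.coe_eq.2 ?_
    filter_upwards [U.isOpen.mem_nhds hp] with q hq
    have hq' : q ∈ U := hq
    simp [hq']
  map_mul' f g := by
    refine Filter.Germ.coe_eq.2 (Filter.Eventually.of_forall fun q => ?_)
    by_cases hq : q ∈ U <;> simp [hq]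
  map_zero' := by
    refine Filter.Germ.coe_eq.2 (Filter.Eventually.of_forall fun q => ?_)
    by_cases hq : q ∈ U <;> simp [hq]
  map_add' f g := by
    refine Filter.Germ.coe_eq.2 (Filter.Eventually.of_forall fun q => ?_)
    by_cases hq : q ∈ U <;> simp [hq]
  commutes' c := by
    refine Filter.Germ.coe_eq.2 ?_
    filter_upwards [U.isOpen.mem_nhds hp] with q hq
    have hq' : q ∈ U := hq
    simp [hq']

/-- The functions on `U` all of whose germs are holomorphic. -/
def holoFunctions (U : Opens (Torus τ)) : Subalgebra ℂ (U → ℂ) :=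
  ⨅ p : U, (holoGerms p.1).comap (rawGerm U p.1 p.2)

theorem mem_holoFunctions {U : Opens (Torus τ)} {f : U → ℂ} :
    f ∈ holoFunctions U ↔ ∀ (p : Torus τ) (hp : p ∈ U), rawGerm U p hp f ∈ holoGerms p := by
  simp only [holoFunctions, Algebra.mem_iInf, Subalgebra.mem_comap]
  exact ⟨fun h p hp => h ⟨p, hp⟩, fun h p => h p.1 p.2⟩

/-- The ring `𝒪_C(U)`. -/
def Holo (U : Opens (Torus τ)) : Type := holoFunctions U

instance (U : Opens (Torus τ)) : CommRing (Holo U) := inferInstanceAs (CommRing (holoFunctions U))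

instance (U : Opens (Torus τ)) : Algebra ℂ (Holo U) :=
  inferInstanceAs (Algebra ℂ (holoFunctions U))

/-- The homomorphism `𝒪_C(U) → 𝒪_{C,p}` taking germs at `p ∈ U`. -/
def germ (U : Opens (Torus τ)) (p : Torus τ) (hp : p ∈ U) : Holo U →ₐ[ℂ] LocalRing p :=
  (((rawGerm U p hp).comp (holoFunctions U).val).codRestrict (holoGerms p)
    fun h => mem_holoFunctions.1 h.2 p hp : holoFunctions U →ₐ[ℂ] holoGerms p)

theorem rawGerm_restrict {U U' : Opens (Torus τ)} (hU : U' ≤ U) (f : U → ℂ) (p : Torus τ)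
    (hp : p ∈ U') :
    rawGerm U' p hp (fun q => f ⟨q.1, hU q.2⟩) = rawGerm U p (hU hp) f := by
  refine Filter.Germ.coe_eq.2 ?_
  filter_upwards [U'.isOpen.mem_nhds hp] with q hq
  have hq' : q ∈ U' := hq
  simp [hq', hU hq']

/-- The restriction `𝒪_C(U) → 𝒪_C(U')` for `U' ⊆ U`. -/
def resHolo {U U' : Opens (Torus τ)} (hU : U' ≤ U) (h : Holo U) : Holo U' :=
  ⟨fun q => h.1 ⟨q.1, hU q.2⟩, mem_holoFunctions.2 fun p hp => by
    rw [rawGerm_restrict hU]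
    exact mem_holoFunctions.1 h.2 _ _⟩

theorem germ_resHolo {U U' : Opens (Torus τ)} (hU : U' ≤ U) (h : Holo U) (p : Torus τ)
    (hp : p ∈ U') : germ U' p hp (resHolo hU h) = germ U p (hU hp) h :=
  Subtype.ext (rawGerm_restrict hU h.1 p hp)

/-! ### Framed zero-dimensional quotients -/

/-- A point of `Quot^{H⁰}(𝒪_C ⊗ V, dim V)` for a finite-dimensional complex vector space `V`
(for `V = ℂ^r` this is `Quot^{H⁰}(𝒪_C^{⊕ r}, r)`): a quotient `𝒪_C ⊗ V → F → 0` with `F` of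
finite length `dim V` such that `V = H⁰(𝒪_C ⊗ V) → H⁰(F)` is surjective.

A quotient with zero-dimensional `F` is the same as the family of its kernels in the stalks, and
then `H⁰(F)` is the product of the stalks of `F`. As `V` and `H⁰(F)` have the same dimension,
surjectivity means bijectivity; conversely, bijectivity forces `F` to have finite support and
length `dim V`. -/
structure FramedQuot (τ : UpperHalfPlane) (V : Type*) [AddCommGroup V] [Module ℂ V] where
  /-- the stalk at `p` of the kernel of `𝒪_C ⊗ V → F` -/
  ker : ∀ p : Torus τ, Submodule (LocalRing p) (LocalRing p ⊗[ℂ] V)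
  bijective : Function.Bijective fun (v : V) (p : Torus τ) => (ker p).mkQ ((1 : LocalRing p) ⊗ₜ[ℂ] v)

namespace FramedQuot

variable {V : Type*} [AddCommGroup V] [Module ℂ V] (Q : FramedQuot τ V)

/-- The stalk `F_p` of the quotient sheaf, an `𝒪_{C,p}`-module. -/
abbrev Stalk (p : Torus τ) : Type _ := (LocalRing p ⊗[ℂ] V) ⧸ Q.ker p

/-- The length of the stalk `F_p`, i.e. its complex dimension. -/
def length (p : Torus τ) : ℕ := Module.finrank ℂ (Q.Stalk p)

/-- The point-set support of `F`. -/
def support : Set (Torus τ) := {p | Nontrivial (Q.Stalk p)}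

/-- The isomorphism `V ≃ H⁰(F) = ∏_p F_p`. -/
def frame : V ≃ₗ[ℂ] ∀ p, Q.Stalk p :=
  LinearEquiv.ofBijective
    (LinearMap.pi fun p => ((Q.ker p).mkQ.restrictScalars ℂ).comp
      (TensorProduct.mk ℂ (LocalRing p) V 1))
    Q.bijective

open Classical in
/-- The action of `h ∈ 𝒪_C(U)` on `V ≃ H⁰(F)` through the `𝒪_C`-module structure of `F`
(with `h` extended by zero outside `U`; this is only used when `F` is supported in `U`). -/
def act (U : Opens (Torus τ)) (h : Holo U) (v : V) : V :=
  Q.frame.symm fun p => if hp : p ∈ U then germ U p hp h • Q.frame v p else 0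

end FramedQuot

/-! ### Stratified subsets of `S¹ × C` -/

/-- `N ⊆ S¹ × C` is an embedded (not necessarily closed) smooth submanifold of dimension `d`:
in the universal cover `ℝ × ℂ`, it is near each of its points carried by a smooth local
diffeomorphism to a piece of a linear subspace of dimension `d`. -/
def IsSmoothSubmanifold (d : ℕ) (N : Set (Circle × Torus τ)) : Prop :=
  ∀ y : ℝ × ℂ, (Circle.exp y.1, proj τ y.2) ∈ N →
    ∃ (Φ : OpenPartialHomeomorph (ℝ × ℂ) (ℝ × ℂ)) (L : Submodule ℝ (ℝ × ℂ)),
      y ∈ Φ.source ∧ ContDiffOn ℝ ∞ Φ Φ.source ∧ ContDiffOn ℝ ∞ Φ.symm Φ.target ∧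
      Module.finrank ℝ L = d ∧
      ∀ w ∈ Φ.source, (Circle.exp w.1, proj τ w.2) ∈ N ↔ Φ w ∈ L

/-- `S ⊆ S¹ × C` is stratified by smooth manifolds: it is a finite disjoint union of embedded
smooth submanifolds (the strata). -/
def IsStratified (S : Set (Circle × Torus τ)) : Prop :=
  ∃ (k : ℕ) (N : Fin k → Set (Circle × Torus τ)),
    S = ⋃ i, N i ∧ Pairwise (fun i j => Disjoint (N i) (N j)) ∧
      ∀ i, ∃ d, IsSmoothSubmanifold d (N i)

/-! ### Morphisms from an Azumaya circle with a fundamental module -/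

section Morphism

variable (τ) (F : Type*) [NormedAddCommGroup F] [NormedSpace ℂ F]
  (E : Circle → Type*) [TopologicalSpace (Bundle.TotalSpace F E)]
  [∀ x, TopologicalSpace (E x)] [∀ x, AddCommGroup (E x)] [∀ x, Module ℂ (E x)]
  [FiberBundle F E]

/-- The section `s` of `E` is smooth on `V ⊆ S¹`. -/
def SmoothOn (s : ∀ x, E x) (V : Set Circle) : Prop :=
  ContMDiffOn (𝓡 1) ((𝓡 1).prod 𝓘(ℝ, F)) ∞ (fun x => Bundle.TotalSpace.mk' F x (s x)) V

/-- A morphism `φ : (S^{1,Az}, ℰ) → C`, where `ℰ` is the sheaf of smooth sections of the complex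
vector bundle `E` over `S¹`.

It is a smooth family of framed quotients `𝒪_C ⊗ E_x → Ẽ_x → 0` parametrized by `x ∈ S¹`. (For the
frame bundle `P` of `E`, giving an element of `Quot^{H⁰}(𝒪_C ⊗ E_x)` for each `x` is the same as
giving a `GL_r(ℂ)`-equivariant map `P → Quot^{H⁰}(𝒪_C^{⊕ r}, r)`.) Smoothness is that of the
map to the complex manifold `Quot^{H⁰}`: its open charts are the sets of quotients supported in a
given open `U ⊆ C`, with the matrices by which functions `h ∈ 𝒪_C(U)` act as coordinates. In other
words, over an open `V ⊆ S¹` over which the support lies in `U`, the pull-back `φ^♯ h` is a smooth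
section of `End(E)`, i.e. it maps smooth sections of `E` to smooth sections. -/
structure AzMorphism where
  fib : ∀ x : Circle, FramedQuot τ (E x)
  isOpen_support : ∀ U : Opens (Torus τ), IsOpen {x | (fib x).support ⊆ (U : Set (Torus τ))}
  smooth : ∀ (U : Opens (Torus τ)) (h : Holo U) (V : Set Circle), IsOpen V →
    (∀ x ∈ V, (fib x).support ⊆ (U : Set (Torus τ))) → ∀ s : ∀ x, E x, SmoothOn F E s V →
      SmoothOn F E (fun x => (fib x).act U h (s x)) V
  /-- The point-set support of the sheaf `Ẽ` on `S¹ × C` is stratified by smooth manifolds. -/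
  stratified : IsStratified {y : Circle × Torus τ | y.2 ∈ (fib y.1).support}

end Morphism

namespace AzMorphism

variable {F : Type*} [NormedAddCommGroup F] [NormedSpace ℂ F]
  {E : Circle → Type*} [TopologicalSpace (Bundle.TotalSpace F E)]
  [∀ x, TopologicalSpace (E x)] [∀ x, AddCommGroup (E x)] [∀ x, Module ℂ (E x)]
  [FiberBundle F E]

/-- The multiplicity `l(x, p)`, the length of the stalk at `p` of `Ẽ_x = Ẽ|_{{x} × C}`. The function
`l` is the cycle on `S¹ × C` carried by the support of `Ẽ` with its multiplicities. -/
def mult (φ : AzMorphism τ F E) (x : Circle) (p : Torus τ) : ℕ := (φ.fib x).length p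

/-! #### The push-forward sheaf -/

/-- Families of elements of the stalks `(Ẽ_x)_p` for `x ∈ S¹`, `p ∈ U`. -/
def Sec (φ : AzMorphism τ F E) (U : Opens (Torus τ)) : Type _ :=
  ∀ (x : Circle) (p : U), (φ.fib x).Stalk p.1

instance (φ : AzMorphism τ F E) (U : Opens (Torus τ)) : AddCommGroup (φ.Sec U) :=
  inferInstanceAs (AddCommGroup (∀ (x : Circle) (p : U), (φ.fib x).Stalk p.1))

instance (φ : AzMorphism τ F E) (U : Opens (Torus τ)) : SMul (Holo U) (φ.Sec U) :=
  ⟨fun h σ x p => germ U p.1 p.2 h • σ x p⟩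

theorem smul_sec (φ : AzMorphism τ F E) {U : Opens (Torus τ)} (h : Holo U) (σ : φ.Sec U)
    (x : Circle) (p : U) : (h • σ) x p = germ U p.1 p.2 h • σ x p := rfl

instance (φ : AzMorphism τ F E) (U : Opens (Torus τ)) : Module (Holo U) (φ.Sec U) where
  one_smul σ := by funext x p; rw [smul_sec, map_one, one_smul]
  mul_smul a b σ := by funext x p; rw [smul_sec, map_mul, mul_smul, smul_sec, smul_sec]
  smul_zero a := by funext x p; rw [smul_sec]; exact smul_zero (germ U p.1 p.2 a)
  smul_add a σ ρ := by funext x p; rw [smul_sec]; exact smul_add (germ U p.1 p.2 a) _ _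
  add_smul a b σ := by funext x p; rw [smul_sec, map_add, add_smul]; rfl
  zero_smul σ := by funext x p; rw [smul_sec, map_zero, zero_smul]; rfl

/-- `σ` is given over `V × W` by the finite sum `∑ h_i ⊗ s_i`, with `h_i ∈ 𝒪_C(W)` and `s_i` a
smooth section of `E` over `V`. -/
def IsGivenBy (φ : AzMorphism τ F E) {U : Opens (Torus τ)} (σ : φ.Sec U) (V : Set Circle)
    (W : Opens (Torus τ)) (hW : W ≤ U) : Prop :=
  ∃ (ι : Type) (_ : Fintype ι) (h : ι → Holo W) (s : ι → ∀ x, E x),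
    (∀ i, SmoothOn F E (s i) V) ∧
    ∀ x ∈ V, ∀ (p : Torus τ) (hp : p ∈ W),
      σ x ⟨p, hW hp⟩ = ∑ i, ((φ.fib x).ker p).mkQ (germ W p hp (h i) ⊗ₜ[ℂ] s i x)

/-- The `𝒪_C(U)`-module `(φ_* ℰ)(U) = (pr_{2*} Ẽ)(U) = Ẽ(S¹ × U)`. Here `Ẽ` is the quotient sheaf
on `S¹ × C` of the `𝒪_{S¹} ⊗ 𝒪_C`-module generated by the smooth sections of `E`, so that its
sections are those which are locally given by finite sums `∑ h_i ⊗ s_i`. -/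
def pushforward (φ : AzMorphism τ F E) (U : Opens (Torus τ)) : Submodule (Holo U) (φ.Sec U) where
  carrier := {σ | ∀ (x : Circle) (p : Torus τ), p ∈ U → ∃ (V : Set Circle) (W : Opens (Torus τ))
    (hW : W ≤ U), IsOpen V ∧ x ∈ V ∧ p ∈ W ∧ φ.IsGivenBy σ V W hW}
  zero_mem' x p hp := ⟨Set.univ, U, le_rfl, isOpen_univ, trivial, hp, Empty, inferInstance,
    Empty.elim, Empty.elim, fun i => i.elim, fun _ _ _ _ => rfl⟩
  add_mem' := by
    intro σ ρ hσ hρ x p hp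
    obtain ⟨V, W, hW, hV, hx, hpW, ι, _, h, s, hs, H⟩ := hσ x p hp
    obtain ⟨V', W', hW', hV', hx', hpW', ι', _, h', s', hs', H'⟩ := hρ x p hp
    refine ⟨V ∩ V', W ⊓ W', inf_le_left.trans hW, hV.inter hV', ⟨hx, hx'⟩, ⟨hpW, hpW'⟩,
      ι ⊕ ι', inferInstance,
      Sum.elim (fun i => resHolo inf_le_left (h i)) (fun i => resHolo inf_le_right (h' i)),
      Sum.elim s s', ?_, ?_⟩
    · rintro (i | i)
      · exact (hs i).mono Set.inter_subset_left
      · exact (hs' i).mono Set.inter_subset_right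
    · intro y hy q hq
      have e : (σ + ρ) y ⟨q, (inf_le_left.trans hW) hq⟩ =
        σ y ⟨q, hW hq.1⟩ + ρ y ⟨q, hW' hq.2⟩ := rfl
      rw [e, H y hy.1 q hq.1, H' y hy.2 q hq.2, Fintype.sum_sum_type]
      simp only [Sum.elim_inl, Sum.elim_inr, germ_resHolo]
  smul_mem' := by
    intro a σ hσ x p hp
    obtain ⟨V, W, hW, hV, hx, hpW, ι, _, h, s, hs, H⟩ := hσ x p hp
    refine ⟨V, W, hW, hV, hx, hpW, ι, inferInstance, fun i => resHolo hW a * h i, s, hs, ?_⟩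
    intro y hy q hq
    have e : (a • σ) y ⟨q, hW hq⟩ = germ U q (hW hq) a • σ y ⟨q, hW hq⟩ := rfl
    rw [e, H y hy q hq, Finset.smul_sum]
    refine Finset.sum_congr rfl fun i _ => ?_
    rw [map_mul, germ_resHolo, ← map_smul, TensorProduct.smul_tmul', smul_eq_mul]

/-- The restriction maps of the sheaf `φ_* ℰ`. -/
def restrict (φ : AzMorphism τ F E) {U U' : Opens (Torus τ)} (hU : U' ≤ U)
    (σ : φ.pushforward U) : φ.pushforward U' :=
  ⟨fun x p => σ.1 x ⟨p.1, hU p.2⟩, by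
    intro x p hp
    obtain ⟨V, W, hW, hV, hx, hpW, ι, _, h, s, hs, H⟩ := σ.2 x p (hU hp)
    refine ⟨V, W ⊓ U', inf_le_right, hV, hx, ⟨hpW, hp⟩, ι, inferInstance,
      fun i => resHolo inf_le_left (h i), s, hs, ?_⟩
    intro y hy q hq
    simp only [germ_resHolo]
    exact H y hy q hq.1⟩

/-! #### The image cycle -/

/-- A smooth real 1-form on `C`, in terms of the trivialization of the tangent bundle
of `C` by translations. -/
def OneForm (τ : UpperHalfPlane) : Type :=
  {η : Torus τ → ℂ →L[ℝ] ℝ // ContDiff ℝ ∞ fun z : ℂ => η (proj τ z)}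

/-- The integral of a 1-form along the curve in `C` with lift `γ : [0, 2π] → ℂ`. -/
def pathIntegral (γ : ℝ → ℂ) (η : OneForm τ) : ℝ :=
  ∫ t in (0 : ℝ)..(2 * Real.pi), η.1 (proj τ (γ t)) (deriv γ t)

/-- A finite family of curves in `C` (given by absolutely continuous lifts `[0, 2π] → ℂ`) is a
system of sheets of `φ` if for each angle `t` the point `p` lies on exactly `l(e^{it}, p)` of
them. So the graphs of the sheets, with the orientation that comes from the one of `S¹`, form
the cycle on `S¹ × C` carried by the support of `Ẽ` with its multiplicities. -/
def IsSheets (φ : AzMorphism τ F E) {ι : Type} [Fintype ι] (γ : ι → ℝ → ℂ) : Prop :=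
  (∀ i, AbsolutelyContinuousOnInterval (γ i) 0 (2 * Real.pi)) ∧
  ∀ t ∈ Set.Icc (0 : ℝ) (2 * Real.pi), ∀ p : Torus τ,
    Nat.card {i // proj τ (γ i t) = p} = φ.mult (Circle.exp t) p

/-- The 1-cycle `T` on `C`, as a current (a functional on 1-forms), is the image cycle of `φ`:
the push-forward to `C` of the oriented support of `Ẽ` in `S¹ × C` with its multiplicities. -/
def IsImageCycle (φ : AzMorphism τ F E) (T : OneForm τ → ℝ) : Prop :=
  ∃ (ι : Type) (_ : Fintype ι) (γ : ι → ℝ → ℂ), φ.IsSheets γ ∧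
    ∀ η, T η = ∑ i, pathIntegral (γ i) η

end AzMorphism

/-- `φ₃_* ℰ₃ ≅ φ₁_* ℰ₁ ⊕ φ₂_* ℰ₂` as sheaves of `𝒪_C`-modules: a family of isomorphisms of
`𝒪_C(U)`-modules, compatible with the restrictions. -/
def PushforwardIsoDirectSum
    {F₁ F₂ F₃ : Type*} [NormedAddCommGroup F₁] [NormedSpace ℂ F₁] [NormedAddCommGroup F₂]
    [NormedSpace ℂ F₂] [NormedAddCommGroup F₃] [NormedSpace ℂ F₃]
    {E₁ E₂ E₃ : Circle → Type*}
    [TopologicalSpace (Bundle.TotalSpace F₁ E₁)] [∀ x, TopologicalSpace (E₁ x)]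
    [∀ x, AddCommGroup (E₁ x)] [∀ x, Module ℂ (E₁ x)] [FiberBundle F₁ E₁]
    [TopologicalSpace (Bundle.TotalSpace F₂ E₂)] [∀ x, TopologicalSpace (E₂ x)]
    [∀ x, AddCommGroup (E₂ x)] [∀ x, Module ℂ (E₂ x)] [FiberBundle F₂ E₂]
    [TopologicalSpace (Bundle.TotalSpace F₃ E₃)] [∀ x, TopologicalSpace (E₃ x)]
    [∀ x, AddCommGroup (E₃ x)] [∀ x, Module ℂ (E₃ x)] [FiberBundle F₃ E₃]
    (φ₃ : AzMorphism τ F₃ E₃) (φ₁ : AzMorphism τ F₁ E₁) (φ₂ : AzMorphism τ F₂ E₂) : Prop :=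
  ∃ e : ∀ U : Opens (Torus τ),
      φ₃.pushforward U ≃ₗ[Holo U] (φ₁.pushforward U × φ₂.pushforward U),
    ∀ (U U' : Opens (Torus τ)) (hU : U' ≤ U) (σ : φ₃.pushforward U),
      e U' (φ₃.restrict hU σ) = (φ₁.restrict hU (e U σ).1, φ₂.restrict hU (e U σ).2)

end AzumayaCircle

end

noncomputable section

namespace AzumayaCircle

variable {τ : UpperHalfPlane}

/-! ### The covering `ℝ × ℂ → S¹ × C` and smooth functions on `S¹ × C` -/

/-! The required morphism is the fibrewise direct sum: its kernel at `p` is that of `𝒪_p ⊗ (V₁ ⊕ V₂)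
→ F₁,p ⊕ F₂,p` (`FramedQuot.prod`). The framing, the action of functions, lengths, smoothness,
sheets and local presentations of sections all split into components, so both claims are formal.

The real difficulty is the stratification. The new support is the union of the two old ones, and
embedded curves may meet in a Cantor set and accumulate on each other. Fibres over `S¹` are finite,
so strata have dimension at most one (`IsSmoothSubmanifold.dim_le_one`). For two curves `N` and `P`,
removing one from the other goes wrong only at `A = P ∩ (closure N \ N)` and `B = N ∩ (closure P \
P)`. Submanifolds are locally closed, so `closure A` misses `N` and `closure B` misses `P`. If `f`,
`f'` are smooth, nonnegative and vanish exactly on these closures, then `g = f / (f + f')` is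
differentiable along both curves, `0` on `A` and `1` on `B`. By Sard in dimension one, some level
`c` in `(0, 1)` meets both curves discretely (`IsCurve.exists_cut`). The overlap goes to `N` where
`g > c` and to `P` where `g < c`; what remains off the level is relatively open in its curve, and
the level adds only discrete sets (`IsCurveUnion.union_curve`). Adding curves one by one handles
finite unions. -/

/-- The universal covering of `S¹ × C`. -/
def cover (τ : UpperHalfPlane) (y : ℝ × ℂ) : Circle × Torus τ := (Circle.exp y.1, proj τ y.2)

theorem continuous_cover : Continuous (cover τ) :=
  (Circle.exp.continuous.comp continuous_fst).prodMk
    (QuotientAddGroup.continuous_mk.comp continuous_snd)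

theorem isOpenMap_cover : IsOpenMap (cover τ) :=
  isLocalHomeomorph_circleExp.isOpenMap.prodMap QuotientAddGroup.isOpenMap_coe

theorem cover_surjective : Function.Surjective (cover τ) :=
  Circle.exp_surjective.prodMap QuotientAddGroup.mk_surjective

/-- The coordinate of `ℂ` along `τ` in the real basis `1, τ`. -/
def coordTau (τ : UpperHalfPlane) : ℂ →+ ℝ where
  toFun z := z.im / τ.im
  map_zero' := by simp
  map_add' := by intros; simp [add_div]

/-- The coordinate of `ℂ` along `1` in the real basis `1, τ`. -/
def coordOne (τ : UpperHalfPlane) : ℂ →+ ℝ where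
  toFun z := z.re - z.im / τ.im * τ.re
  map_zero' := by simp
  map_add' := by intros; simp; ring

theorem coord_decomp (z : ℂ) : z = coordOne τ z + coordTau τ z * (τ : ℂ) := by
  have h := τ.im_ne_zero
  apply Complex.ext
  · simp [coordOne, coordTau]
  · simp [coordOne, coordTau]
    field_simp

theorem coord_add_mul (a b : ℝ) :
    coordOne τ (a + b * (τ : ℂ)) = a ∧ coordTau τ (a + b * (τ : ℂ)) = b := by
  have h := τ.im_ne_zero
  constructor
  · simp [coordOne]
    field_simp
    ring
  · simp [coordTau]
    field_simp

theorem mem_lattice_iff {z : ℂ} :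
    z ∈ lattice τ ↔ (∃ m : ℤ, (m : ℝ) = coordOne τ z) ∧ ∃ n : ℤ, (n : ℝ) = coordTau τ z := by
  rw [lattice, AddSubgroup.mem_closure_pair]
  constructor
  · rintro ⟨m, n, rfl⟩
    have := coord_add_mul (τ := τ) m n
    simp only [zsmul_eq_mul, mul_one]
    exact ⟨⟨m, by simpa using this.1.symm⟩, ⟨n, by simpa using this.2.symm⟩⟩
  · rintro ⟨⟨m, hm⟩, n, hn⟩
    refine ⟨m, n, ?_⟩
    rw [coord_decomp (τ := τ) z, ← hm, ← hn]
    simp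

theorem continuous_coordOne : Continuous (coordOne τ) := by
  change Continuous fun z : ℂ => z.re - z.im / τ.im * τ.re
  fun_prop

theorem continuous_coordTau : Continuous (coordTau τ) := by
  change Continuous fun z : ℂ => z.im / τ.im
  fun_prop

theorem contDiff_coordOne : ContDiff ℝ ∞ (coordOne τ) := by
  change ContDiff ℝ ∞ fun z : ℂ => Complex.reCLM z - Complex.imCLM z / τ.im * τ.re
  fun_prop

theorem contDiff_coordTau : ContDiff ℝ ∞ (coordTau τ) := by
  change ContDiff ℝ ∞ fun z : ℂ => Complex.imCLM z / τ.im
  fun_prop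

theorem countable_lattice : (lattice τ : Set ℂ).Countable := by
  have : (lattice τ : Set ℂ) = Set.range fun q : ℤ × ℤ => q.1 • (1 : ℂ) + q.2 • (τ : ℂ) := by
    ext z
    simp [lattice, AddSubgroup.mem_closure_pair]
  rw [this]
  exact Set.countable_range _

/-- The set of points of `ℂ` over a countable subset of the torus is countable. -/
theorem countable_proj_preimage {s : Set (Torus τ)} (hs : s.Countable) :
    (proj τ ⁻¹' s).Countable := by
  have : proj τ ⁻¹' s = ⋃ p ∈ s, proj τ ⁻¹' {p} := by ext; simp
  rw [this]
  refine hs.biUnion fun p _ => ?_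
  obtain ⟨z, rfl⟩ := QuotientAddGroup.mk_surjective p
  refine (countable_lattice (τ := τ)).image (fun w => z + w) |>.mono fun w hw => ?_
  exact ⟨-z + w, QuotientAddGroup.eq.1 (Eq.symm hw), by simp⟩

/-- Fractional parts of the two real coordinates move any point into the closed fundamental
parallelogram. -/
instance : CompactSpace (Torus τ) := by
  constructor
  have hc : IsCompact (Set.Icc (0 : ℝ) 1 ×ˢ Set.Icc (0 : ℝ) 1) := isCompact_Icc.prod isCompact_Icc
  have hf : Continuous fun q : ℝ × ℝ => proj τ (q.1 + q.2 * (τ : ℂ)) :=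
    QuotientAddGroup.continuous_mk.comp (by fun_prop)
  convert hc.image hf
  refine (Set.eq_univ_of_forall fun p => ?_).symm
  obtain ⟨z, rfl⟩ := QuotientAddGroup.mk_surjective p
  refine ⟨(Int.fract (coordOne τ z), Int.fract (coordTau τ z)),
    ⟨⟨Int.fract_nonneg _, (Int.fract_lt_one _).le⟩, ⟨Int.fract_nonneg _, (Int.fract_lt_one _).le⟩⟩,
    QuotientAddGroup.eq.2 ?_⟩
  rw [mem_lattice_iff]
  simp only [map_add, map_neg, (coord_add_mul _ _).1, (coord_add_mul _ _).2, Int.fract]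
  exact ⟨⟨⌊coordOne τ z⌋, by ring⟩, ⟨⌊coordTau τ z⌋, by ring⟩⟩

/-- A homomorphism from the torus to `(ℝ / ℤ)²`, in fact an isomorphism. -/
def torusHom (τ : UpperHalfPlane) : Torus τ →+ AddCircle (1 : ℝ) × AddCircle (1 : ℝ) :=
  QuotientAddGroup.lift (lattice τ)
    (((QuotientAddGroup.mk' _).comp (coordOne τ)).prod ((QuotientAddGroup.mk' _).comp (coordTau τ)))
    fun z hz => by
      obtain ⟨⟨m, hm⟩, n, hn⟩ := mem_lattice_iff.1 hz
      refine Prod.ext ((AddCircle.coe_eq_zero_iff _).2 ⟨m, ?_⟩)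
        ((AddCircle.coe_eq_zero_iff _).2 ⟨n, ?_⟩)
      · simpa using hm
      · simpa using hn

theorem torusHom_injective : Function.Injective (torusHom τ) := by
  refine (injective_iff_map_eq_zero _).2 fun p hp => ?_
  obtain ⟨z, rfl⟩ := QuotientAddGroup.mk_surjective p
  refine (QuotientAddGroup.eq_zero_iff z).2 (mem_lattice_iff.2 ?_)
  obtain ⟨m, hm⟩ := (AddCircle.coe_eq_zero_iff (1 : ℝ)).1 (congrArg Prod.fst hp)
  obtain ⟨n, hn⟩ := (AddCircle.coe_eq_zero_iff (1 : ℝ)).1 (congrArg Prod.snd hp)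
  exact ⟨⟨m, by simpa using hm⟩, n, by simpa using hn⟩

/-- A closed embedding of `S¹ × C` into `ℂ³`. -/
def toEuclid (τ : UpperHalfPlane) (q : Circle × Torus τ) : ℂ × ℂ × ℂ :=
  (q.1, AddCircle.toCircle (torusHom τ q.2).1, AddCircle.toCircle (torusHom τ q.2).2)

theorem toEuclid_cover (y : ℝ × ℂ) : toEuclid τ (cover τ y) =
    (Complex.exp (y.1 * Complex.I), Complex.exp ((2 * Real.pi * coordOne τ y.2 : ℝ) * Complex.I),
      Complex.exp ((2 * Real.pi * coordTau τ y.2 : ℝ) * Complex.I)) := by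
  have h1 : (torusHom τ (proj τ y.2)).1 = (coordOne τ y.2 : AddCircle (1 : ℝ)) := rfl
  have h2 : (torusHom τ (proj τ y.2)).2 = (coordTau τ y.2 : AddCircle (1 : ℝ)) := rfl
  simp only [toEuclid, cover, h1, h2, AddCircle.toCircle_apply_mk, Circle.coe_exp, div_one]

theorem contDiff_toEuclid_cover : ContDiff ℝ ∞ fun y => toEuclid τ (cover τ y) := by
  have h1 := contDiff_coordOne (τ := τ)
  have h2 := contDiff_coordTau (τ := τ)
  have h3 : ContDiff ℝ ∞ fun t : ℝ => Complex.exp (t * Complex.I) :=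
    (Complex.contDiff_exp (𝕜 := ℝ)).comp (Complex.ofRealCLM.contDiff.mul contDiff_const)
  simp only [toEuclid_cover]
  exact (h3.comp contDiff_fst).prodMk
    ((h3.comp (contDiff_const.mul (h1.comp contDiff_snd))).prodMk
      (h3.comp (contDiff_const.mul (h2.comp contDiff_snd))))

/-- The source is compact, so continuity, which may be tested on the covering, and injectivity
suffice. -/
theorem isClosedEmbedding_toEuclid : Topology.IsClosedEmbedding (toEuclid τ) := by
  refine Continuous.isClosedEmbedding ?_ ?_
  · have hq : Topology.IsQuotientMap (cover τ) :=
      isOpenMap_cover.isQuotientMap continuous_cover cover_surjective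
    exact hq.continuous_iff.2 contDiff_toEuclid_cover.continuous
  · rintro ⟨x, p⟩ ⟨x', p'⟩ h
    simp only [toEuclid, Prod.mk.injEq] at h
    have hi := AddCircle.injective_toCircle (one_ne_zero (α := ℝ))
    refine Prod.ext (Circle.ext h.1) (torusHom_injective (Prod.ext ?_ ?_))
    · exact hi (Circle.ext h.2.1)
    · exact hi (Circle.ext h.2.2)

/-- Every closed subset of `S¹ × C` is the zero set of a nonnegative smooth function. -/
theorem exists_smooth_zero_iff {K : Set (Circle × Torus τ)} (hK : IsClosed K) :
    ∃ f : Circle × Torus τ → ℝ, ContDiff ℝ ∞ (fun y => f (cover τ y)) ∧ (∀ q, 0 ≤ f q) ∧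
      ∀ q, f q = 0 ↔ q ∈ K := by
  -- The image of `K` in `ℂ³` is closed, so its complement is the support of a smooth function,
  -- which is pulled back.
  obtain ⟨g, hg, hd, hr⟩ := IsOpen.exists_contDiff_support_eq (E := ℂ × ℂ × ℂ) (n := ⊤)
    (isClosedEmbedding_toEuclid.isClosedMap K hK).isOpen_compl
  refine ⟨fun q => g (toEuclid τ q), hd.comp contDiff_toEuclid_cover,
    fun q => (hr ⟨_, rfl⟩).1, fun q => ?_⟩
  have h : g (toEuclid τ q) ≠ 0 ↔ toEuclid τ q ∉ toEuclid τ '' K := by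
    rw [← Function.mem_support, hg, Set.mem_compl_iff]
  rw [isClosedEmbedding_toEuclid.injective.mem_set_image] at h
  exact not_iff_not.1 h

/-! ### Submanifolds of `S¹ × C` -/

theorem eventually_nhds_cover {y : ℝ × ℂ} {A : Circle × Torus τ → Prop}
    (h : ∀ᶠ w in 𝓝 y, A (cover τ w)) : ∀ᶠ x in 𝓝 (cover τ y), A x :=
  isOpenMap_cover.nhds_le y h

theorem eventually_of_nhds_cover {y : ℝ × ℂ} {A : Circle × Torus τ → Prop}
    (h : ∀ᶠ x in 𝓝 (cover τ y), A x) : ∀ᶠ w in 𝓝 y, A (cover τ w) :=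
  continuous_cover.continuousAt.eventually h

/-- A relatively open subset of a submanifold is a submanifold. -/
theorem IsSmoothSubmanifold.of_relOpen {d : ℕ} {N A : Set (Circle × Torus τ)}
    (hN : IsSmoothSubmanifold d N) (hA : A ⊆ N) (h : ∀ q ∈ A, ∀ᶠ x in 𝓝 q, x ∈ N → x ∈ A) :
    IsSmoothSubmanifold d A := by
  intro y hy
  obtain ⟨Φ, L, hs, h1, h2, hL, H⟩ := hN y (hA hy)
  obtain ⟨O, hO, hOo, hyO⟩ := eventually_nhds_iff.1 (eventually_of_nhds_cover (h _ hy))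
  refine ⟨Φ.restrOpen O hOo, L, ⟨hs, hyO⟩, ?_, ?_, hL, ?_⟩
  · rw [OpenPartialHomeomorph.coe_restrOpen]
    exact h1.mono fun w hw => hw.1
  · rw [OpenPartialHomeomorph.coe_restrOpen_symm]
    exact h2.mono fun w hw => hw.1
  · intro w hw
    rw [OpenPartialHomeomorph.coe_restrOpen, ← H w hw.1]
    exact ⟨fun hwA => hA hwA, fun hwN => hO w hw.2 hwN⟩

/-- Two lifts of one point differ by integers in the lattice coordinates and by a multiple of `2π`
in the angle; integers of absolute value below one vanish. -/
theorem eventually_eq_of_cover_eq (y : ℝ × ℂ) :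
    ∀ᶠ w in 𝓝 y, cover τ w = cover τ y → w = y := by
  have c1 : ∀ᶠ w : ℝ × ℂ in 𝓝 y, |w.1 - y.1| < 1 :=
    ContinuousAt.eventually_lt (by fun_prop) continuousAt_const (by simp)
  have c2 : ∀ᶠ w : ℝ × ℂ in 𝓝 y, |coordOne τ (-w.2 + y.2)| < 1 :=
    (continuous_coordOne.comp (f := fun w : ℝ × ℂ => -w.2 + y.2) (by fun_prop)).abs.continuousAt
      |>.eventually_lt continuousAt_const (by simp)
  have c3 : ∀ᶠ w : ℝ × ℂ in 𝓝 y, |coordTau τ (-w.2 + y.2)| < 1 :=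
    (continuous_coordTau.comp (f := fun w : ℝ × ℂ => -w.2 + y.2) (by fun_prop)).abs.continuousAt
      |>.eventually_lt continuousAt_const (by simp)
  filter_upwards [c1, c2, c3] with w h1 h2 h3 hw
  have e1 := congrArg Prod.fst hw
  have e2 := QuotientAddGroup.eq.1 (congrArg Prod.snd hw)
  obtain ⟨m, hm⟩ := Circle.exp_eq_exp.1 e1
  obtain ⟨⟨a, ha⟩, b, hb⟩ := mem_lattice_iff.1 e2
  have hint : ∀ n : ℤ, |(n : ℝ)| < 1 → n = 0 := fun n hn => by
    rw [← Int.abs_lt_one_iff]; exact_mod_cast hn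
  rw [← ha] at h2
  rw [← hb] at h3
  rw [hint a h2] at ha
  rw [hint b h3] at hb
  have hm0 : m = 0 := by
    apply hint
    rw [hm, add_sub_cancel_left, abs_mul, abs_of_pos Real.two_pi_pos] at h1
    nlinarith [abs_nonneg (m : ℝ), Real.pi_gt_three]
  refine Prod.ext (by simp [hm, hm0]) ?_
  have := coord_decomp (τ := τ) (-w.2 + y.2)
  rw [← ha, ← hb] at this
  simp only [Int.cast_zero, Complex.ofReal_zero, zero_mul, add_zero] at this
  exact neg_add_eq_zero.1 this

/-- A discrete subset is a submanifold of dimension zero. -/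
theorem isSmoothSubmanifold_zero_of_isolated {A : Set (Circle × Torus τ)}
    (h : ∀ q ∈ A, ∀ᶠ x in 𝓝 q, x ∈ A → x = q) : IsSmoothSubmanifold 0 A := by
  intro y hy
  -- Charts live on the covering, so `O` must exclude other points of `A` and also other lifts of
  -- the same point. The chart is then a translation, with `L = ⊥`.
  obtain ⟨O, hO, hOo, hyO⟩ := eventually_nhds_iff.1
    ((eventually_of_nhds_cover (h _ hy)).and (eventually_eq_of_cover_eq (τ := τ) y))
  refine ⟨(Homeomorph.addRight (-y)).toOpenPartialHomeomorph.restrOpen O hOo, ⊥, ⟨trivial, hyO⟩,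
    ?_, ?_, finrank_bot _ _, ?_⟩
  · rw [OpenPartialHomeomorph.coe_restrOpen]
    exact (contDiff_id.add contDiff_const).contDiffOn
  · rw [OpenPartialHomeomorph.coe_restrOpen_symm]
    exact (contDiff_id.add contDiff_const).contDiffOn
  · intro w hw
    rw [OpenPartialHomeomorph.coe_restrOpen]
    change cover τ w ∈ A ↔ w + -y = 0
    rw [add_neg_eq_zero]
    refine ⟨fun hwA => (hO w hw.2).2 ((hO w hw.2).1 hwA), ?_⟩
    rintro rfl
    exact hy

/-- A chart with `L = 0` sends all nearby points of `N` to the origin and is injective. -/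
theorem IsSmoothSubmanifold.isolated {N : Set (Circle × Torus τ)} (hN : IsSmoothSubmanifold 0 N) :
    ∀ q ∈ N, ∀ᶠ x in 𝓝 q, x ∈ N → x = q := by
  intro q hq
  obtain ⟨y, rfl⟩ := cover_surjective q
  obtain ⟨Φ, L, hs, -, -, hL, H⟩ := hN y hq
  rw [Submodule.finrank_eq_zero] at hL
  subst hL
  refine eventually_nhds_cover ?_
  filter_upwards [Φ.open_source.mem_nhds hs] with w hw hwN
  rw [Φ.injOn hw hs (((H w hw).1 hwN).trans ((H y hs).1 hq).symm)]

/-- A submanifold is locally closed. -/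
theorem IsSmoothSubmanifold.eventually_closure {d : ℕ} {N : Set (Circle × Torus τ)}
    (hN : IsSmoothSubmanifold d N) : ∀ q ∈ N, ∀ᶠ x in 𝓝 q, x ∈ closure N → x ∈ N := by
  intro q hq
  obtain ⟨y, rfl⟩ := cover_surjective q
  obtain ⟨Φ, L, hs, -, -, -, H⟩ := hN y hq
  refine eventually_nhds_cover ?_
  filter_upwards [Φ.open_source.mem_nhds hs] with w hw hwN
  by_contra hcon
  -- `L` is closed, so a point of the chart off `N` has a neighbourhood free of `N`.
  have hL : ∀ᶠ w' in 𝓝 w, Φ w' ∉ L :=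
    (Φ.continuousAt hw).eventually
      (L.closed_of_finiteDimensional.isOpen_compl.mem_nhds fun h => hcon ((H w hw).2 h))
  have : ∀ᶠ x in 𝓝 (cover τ w), x ∉ N := by
    refine eventually_nhds_cover ?_
    filter_upwards [hL, Φ.open_source.mem_nhds hw] with w' h1 h2 h3
    exact h1 ((H w' h2).1 h3)
  exact (mem_closure_iff_frequently.1 hwN) this

/-- Sard in dimension one: along the line `L = ℝ v`, `g` becomes a function `h` of one variable. The
image of its critical set is null, even for merely differentiable `h`, and where `h' ≠ 0` a value is
not repeated nearby. -/
theorem ae_isolated_level_chart {N : Set (Circle × Torus τ)} {g : Circle × Torus τ → ℝ}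
    (hg : ∀ y, cover τ y ∈ N → DifferentiableAt ℝ (fun y => g (cover τ y)) y)
    (Φ : OpenPartialHomeomorph (ℝ × ℂ) (ℝ × ℂ)) (L : Submodule ℝ (ℝ × ℂ))
    (hΦ : ContDiffOn ℝ ∞ Φ.symm Φ.target) (hL : Module.finrank ℝ L = 1)
    (H : ∀ w ∈ Φ.source, cover τ w ∈ N ↔ Φ w ∈ L) :
    ∀ᵐ c : ℝ, ∀ w ∈ Φ.source, cover τ w ∈ N →
      ∀ᶠ x in 𝓝 (cover τ w), x ∈ N → g x = c → x = cover τ w := by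
  obtain ⟨v, hv0, hv⟩ := finrank_eq_one_iff'.1 hL
  -- `ℓ` reads off the parameter `s` of a point `s • v` continuously.
  obtain ⟨ℓ, hℓ⟩ := SeparatingDual.exists_eq_one (R := ℝ) (x := (v : ℝ × ℂ)) (by simpa using hv0)
  set h : ℝ → ℝ := fun s => g (cover τ (Φ.symm (s • (v : ℝ × ℂ)))) with h_def
  have hd : ∀ s, s • (v : ℝ × ℂ) ∈ Φ.target → DifferentiableAt ℝ h s := by
    intro s hs
    have h1 : cover τ (Φ.symm (s • (v : ℝ × ℂ))) ∈ N := by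
      rw [H _ (Φ.map_target hs), Φ.right_inv hs]
      exact L.smul_mem s v.2
    have h2 : DifferentiableAt ℝ Φ.symm (s • (v : ℝ × ℂ)) :=
      (hΦ.contDiffAt (Φ.open_target.mem_nhds hs)).differentiableAt (by simp)
    have h3 : DifferentiableAt ℝ (fun s : ℝ => s • (v : ℝ × ℂ)) s := by fun_prop
    exact DifferentiableAt.comp s (g := fun y => g (cover τ y))
      (f := fun s => Φ.symm (s • (v : ℝ × ℂ))) (hg _ h1)
      (DifferentiableAt.comp s (g := Φ.symm) h2 h3)
  -- Only parameters in the target count: elsewhere `Φ.symm` has no meaning.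
  set Z : Set ℝ := {s | s • (v : ℝ × ℂ) ∈ Φ.target ∧ deriv h s = 0}
  have hZ : MeasureTheory.volume (h '' Z) = 0 := by
    refine MeasureTheory.addHaar_image_eq_zero_of_det_fderivWithin_eq_zero _
      (f' := fun _ => 0) (fun s hs => ?_) fun s _ => by simp
    have := (hd s hs.1).hasDerivAt.hasFDerivAt.hasFDerivWithinAt (s := Z)
    rw [hs.2] at this
    simpa using this
  filter_upwards [MeasureTheory.measure_eq_zero_iff_ae_notMem.1 hZ] with c hc w hw hwN
  refine eventually_nhds_cover ?_
  obtain ⟨s₀, hs₀⟩ := hv ⟨Φ w, (H w hw).1 hwN⟩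
  replace hs₀ : s₀ • (v : ℝ × ℂ) = Φ w := congrArg Subtype.val hs₀
  have hs₀t : s₀ • (v : ℝ × ℂ) ∈ Φ.target := hs₀ ▸ Φ.map_source hw
  have hℓs : ∀ w' s, s • (v : ℝ × ℂ) = Φ w' → ℓ (Φ w') = s := fun w' s e => by simp [← e, hℓ]
  by_cases hgc : g (cover τ w) = c
  · have hne : deriv h s₀ ≠ 0 := fun h0 => hc ⟨s₀, ⟨hs₀t, h0⟩, by
      simp only [h_def, hs₀, Φ.left_inv hw, hgc]⟩
    have hev := (hd s₀ hs₀t).hasDerivAt.eventually_ne (c := c) hne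
    rw [eventually_nhdsWithin_iff] at hev
    have hcont : Filter.Tendsto (fun w' => ℓ (Φ w')) (𝓝 w) (𝓝 s₀) := by
      rw [← hℓs w s₀ hs₀]
      exact ℓ.continuous.continuousAt.comp (Φ.continuousAt hw)
    filter_upwards [hcont.eventually hev, Φ.open_source.mem_nhds hw] with w' h1 h2 h3 h4
    obtain ⟨s, hs⟩ := hv ⟨Φ w', (H w' h2).1 h3⟩
    replace hs : s • (v : ℝ × ℂ) = Φ w' := congrArg Subtype.val hs
    rw [hℓs w' s hs] at h1
    have : s = s₀ := by
      by_contra hss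
      refine h1 hss ?_
      simp only [h_def, hs, Φ.left_inv h2, h4]
    rw [Φ.injOn h2 hw (by rw [← hs, ← hs₀, this])]
  · filter_upwards [(hg w hwN).continuousAt.eventually_ne hgc] with w' h1 _ h2
    exact absurd h2 h1

/-- Almost all levels of a differentiable function on a curve are discrete. -/
theorem IsSmoothSubmanifold.ae_isolated_level {N : Set (Circle × Torus τ)}
    (hN : IsSmoothSubmanifold 1 N) {g : Circle × Torus τ → ℝ}
    (hg : ∀ y, cover τ y ∈ N → DifferentiableAt ℝ (fun y => g (cover τ y)) y) :
    ∀ᵐ c : ℝ, ∀ q ∈ N, ∀ᶠ x in 𝓝 q, x ∈ N → g x = c → x = q := by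
  have : Nonempty (OpenPartialHomeomorph (ℝ × ℂ) (ℝ × ℂ)) := ⟨.refl _⟩
  choose! Φ L hs _ h2 hL H using hN
  -- By the Lindelöf property countably many charts cover the curve, so the exceptional levels still
  -- form a null set.
  obtain ⟨t, htN, htc, ht⟩ := TopologicalSpace.countable_cover_nhdsWithin
    (f := fun y => (Φ y).source) (s := cover τ ⁻¹' N)
    fun y hy => mem_nhdsWithin_of_mem_nhds ((Φ y).open_source.mem_nhds (hs y hy))
  have := (MeasureTheory.ae_ball_iff htc).2 fun y hy =>
    ae_isolated_level_chart hg (Φ y) (L y) (h2 y (htN hy)) (hL y (htN hy)) (H y (htN hy))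
  filter_upwards [this] with c hc q hq
  obtain ⟨y, rfl⟩ := cover_surjective q
  obtain ⟨y', hy', hyy⟩ := Set.mem_iUnion₂.1 (ht hq)
  exact hc y' hy' y hyy hq

/-- A nonempty submanifold all of whose fibres over `S¹` are countable has dimension at most one. -/
theorem IsSmoothSubmanifold.dim_le_one {d : ℕ} {N : Set (Circle × Torus τ)}
    (hN : IsSmoothSubmanifold d N) (hne : N.Nonempty) (hfib : ∀ x, {p | (x, p) ∈ N}.Countable) :
    d ≤ 1 := by
  obtain ⟨q, hq⟩ := hne
  obtain ⟨y, rfl⟩ := cover_surjective q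
  obtain ⟨Φ, L, hs, -, -, hL, H⟩ := hN y hq
  by_contra! hd
  have hrank : 1 < Module.rank ℝ L := by
    rw [← Module.finrank_eq_rank, hL]
    exact_mod_cast hd
  set c : L := ⟨Φ y, (H y hs).1 hq⟩
  have hopen : IsOpen ((↑) ⁻¹' Φ.target : Set L) := Φ.open_target.preimage continuous_subtype_val
  obtain ⟨r, hr, hball⟩ := Metric.isOpen_iff.1 hopen c (Φ.map_source hs)
  -- Blowing a ball up to all of `L` makes `ψ` a continuous injection of a whole vector space into
  -- the preimage of `N`.
  set u := OpenPartialHomeomorph.univBall c r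
  have hut : ∀ v, ((u v : L) : ℝ × ℂ) ∈ Φ.target := fun v => by
    apply hball
    rw [← OpenPartialHomeomorph.univBall_target c hr]
    exact u.map_source (by simp [u])
  set ψ : L → ℝ × ℂ := fun v => Φ.symm (u v)
  have hψc : Continuous ψ := Φ.symm.continuousOn.comp_continuous
    (continuous_subtype_val.comp (OpenPartialHomeomorph.continuous_univBall c r)) hut
  have hψi : Function.Injective ψ := fun a b hab => by
    have h1 := Φ.symm.injOn (hut a) (hut b) hab
    exact u.injOn (by simp [u]) (by simp [u]) (Subtype.ext h1)
  have hψN : ∀ v, cover τ (ψ v) ∈ N := fun v =>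
    (H _ (Φ.map_target (hut v))).2 (by rw [Φ.right_inv (hut v)]; exact (u v).2)
  have hcount : ∀ t : ℝ, {v | (ψ v).1 = t}.Countable := fun t => by
    refine Set.MapsTo.countable_of_injOn (f := fun v => (ψ v).2) ?_ ?_
      (countable_proj_preimage (hfib (Circle.exp t)))
    · intro v hv
      have := hψN v
      rw [cover, show (ψ v).1 = t from hv] at this
      exact this
    · intro a ha b hb hab
      exact hψi (Prod.ext (Eq.trans ha (Eq.symm hb)) hab)
  -- In dimension at least two the complement of a countable set is connected. Hence the angle `(ψ
  -- v).1` cannot take values on both sides of `t`, and it is constant; but then `L` itself would be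
  -- countable.
  have hconn : ∀ t : ℝ, IsPreconnected ((fun v => (ψ v).1) '' {v | (ψ v).1 = t}ᶜ) := fun t =>
    ((hcount t).isPathConnected_compl_of_one_lt_rank hrank).isConnected.isPreconnected.image _
      (continuous_fst.comp hψc).continuousOn
  have hlt : ∀ a b : L, ¬ (ψ a).1 < (ψ b).1 := fun a b hab => by
    obtain ⟨t, h1, h2⟩ := exists_between hab
    obtain ⟨v, hv, hvt⟩ := (hconn t).Icc_subset ⟨a, h1.ne, rfl⟩ ⟨b, h2.ne', rfl⟩ ⟨h1.le, h2.le⟩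
    exact hv hvt
  obtain ⟨v, hv⟩ :=
    ((hcount (ψ c).1).isPathConnected_compl_of_one_lt_rank hrank).nonempty
  exact hv (le_antisymm (not_lt.1 (hlt c v)) (not_lt.1 (hlt v c)))

/-! ### Unions of curves in `S¹ × C` -/

/-- A submanifold of dimension at most one. -/
def IsCurve (N : Set (Circle × Torus τ)) : Prop :=
  IsSmoothSubmanifold 0 N ∨ IsSmoothSubmanifold 1 N

theorem IsCurve.of_relOpen {N A : Set (Circle × Torus τ)} (hN : IsCurve N) (hA : A ⊆ N)
    (h : ∀ q ∈ A, ∀ᶠ x in 𝓝 q, x ∈ N → x ∈ A) : IsCurve A :=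
  hN.imp (·.of_relOpen hA h) (·.of_relOpen hA h)

theorem isCurve_of_isolated {A : Set (Circle × Torus τ)}
    (h : ∀ q ∈ A, ∀ᶠ x in 𝓝 q, x ∈ A → x = q) : IsCurve A :=
  .inl (isSmoothSubmanifold_zero_of_isolated h)

theorem IsCurve.eventually_closure {N : Set (Circle × Torus τ)} (hN : IsCurve N) :
    ∀ q ∈ N, ∀ᶠ x in 𝓝 q, x ∈ closure N → x ∈ N :=
  hN.elim (·.eventually_closure) (·.eventually_closure)

theorem IsCurve.ae_isolated_level {N : Set (Circle × Torus τ)} (hN : IsCurve N)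
    {g : Circle × Torus τ → ℝ}
    (hg : ∀ y, cover τ y ∈ N → DifferentiableAt ℝ (fun y => g (cover τ y)) y) :
    ∀ᵐ c : ℝ, ∀ q ∈ N, ∀ᶠ x in 𝓝 q, x ∈ N → g x = c → x = q := by
  rcases hN with hN | hN
  · exact .of_forall fun c q hq => (hN.isolated q hq).mono fun x hx h _ => hx h
  · exact hN.ae_isolated_level hg

/-- Points of `N` do not lie in the closure of `P ∩ (closure N \ N)`. -/
theorem IsCurve.notMem_closure_frontier {N P : Set (Circle × Torus τ)} (hN : IsCurve N)
    {q : Circle × Torus τ} (hq : q ∈ N) : q ∉ closure (P ∩ (closure N \ N)) := fun h => by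
  obtain ⟨x, h1, h2⟩ := ((mem_closure_iff_frequently.1 h).and_eventually
    (hN.eventually_closure q hq)).exists
  exact h1.2.2 (h2 h1.2.1)

/-- A cut between two curves: a level set which meets both of them discretely, such that one
side contains no limit point of `P` on `N` and the other one no limit point of `N` on `P`. -/
theorem IsCurve.exists_cut {N P : Set (Circle × Torus τ)} (hN : IsCurve N) (hP : IsCurve P) :
    ∃ (g : Circle × Torus τ → ℝ) (c : ℝ),
      (∀ q, q ∈ N ∨ q ∈ P → ContinuousAt g q) ∧
      (∀ q ∈ N, ∀ᶠ x in 𝓝 q, x ∈ N → g x = c → x = q) ∧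
      (∀ q ∈ P, ∀ᶠ x in 𝓝 q, x ∈ P → g x = c → x = q) ∧
      (∀ q ∈ P, q ∉ N → c < g q → q ∉ closure N) ∧
      (∀ q ∈ N, q ∉ P → g q < c → q ∉ closure P) := by
  obtain ⟨f, hf, hf0, hfz⟩ := exists_smooth_zero_iff
    (isClosed_closure (s := P ∩ (closure N \ N)))
  obtain ⟨f', hf', hf0', hfz'⟩ := exists_smooth_zero_iff
    (isClosed_closure (s := N ∩ (closure P \ P)))
  -- `f > 0` on `N` and `f' > 0` on `P`, because each curve misses the closure of its own frontier
  -- points.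
  have hpos : ∀ q, q ∈ N ∨ q ∈ P → f q + f' q ≠ 0 := by
    rintro q (hq | hq)
    · have := (hf0 q).lt_of_ne' (mt (hfz q).1 (hN.notMem_closure_frontier hq))
      linarith [hf0' q, this]
    · have := (hf0' q).lt_of_ne' (mt (hfz' q).1 (hP.notMem_closure_frontier hq))
      linarith [hf0 q, this]
  set g : Circle × Torus τ → ℝ := fun q => f q / (f q + f' q) with g_def
  have hd : ∀ y, (cover τ y ∈ N ∨ cover τ y ∈ P) →
      DifferentiableAt ℝ (fun y => g (cover τ y)) y := fun y hy =>
    have h1 := hf.differentiable (by simp) y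
    have h2 := h1.fun_add (hf'.differentiable (by simp) y)
    by simpa only [g_def, div_eq_mul_inv] using h1.fun_mul (h2.fun_inv (hpos _ hy))
  have hae := (hN.ae_isolated_level fun y hy => hd y (.inl hy)).and
    (hP.ae_isolated_level fun y hy => hd y (.inr hy))
  -- Almost every level is good, so good levels are dense; one strictly between `0` and `1`
  -- separates the two kinds of bad points.
  obtain ⟨c, ⟨hc1, hc2⟩, hc0, hc⟩ : ∃ c, ((∀ q ∈ N, ∀ᶠ x in 𝓝 q, x ∈ N → g x = c → x = q) ∧
      (∀ q ∈ P, ∀ᶠ x in 𝓝 q, x ∈ P → g x = c → x = q)) ∧ c ∈ Set.Ioo (0 : ℝ) 1 := by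
    obtain ⟨c, hc, h⟩ := (MeasureTheory.Measure.dense_of_ae hae).inter_open_nonempty _ isOpen_Ioo
      (Set.nonempty_Ioo.2 one_pos)
    exact ⟨c, h, hc⟩
  refine ⟨g, c, fun q hq => ?_, hc1, hc2, fun q hqP hqN h hcl => ?_, fun q hqN hqP h hcl => ?_⟩
  · obtain ⟨y, rfl⟩ := cover_surjective q
    intro A hA
    exact eventually_nhds_cover ((hd y hq).continuousAt hA)
  · have : f q = 0 := (hfz q).2 (subset_closure ⟨hqP, hcl, hqN⟩)
    rw [g_def] at h
    simp only [this, zero_div] at h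
    linarith
  · have : f' q = 0 := (hfz' q).2 (subset_closure ⟨hqN, hcl, hqP⟩)
    have h1 := hpos q (.inl hqN)
    rw [g_def] at h
    simp only [this, add_zero] at h h1
    rw [div_self h1] at h
    linarith

/-- A finite disjoint union of submanifolds of dimension at most one. -/
def IsCurveUnion (S : Set (Circle × Torus τ)) : Prop :=
  ∃ (ι : Type) (_ : Finite ι) (N : ι → Set (Circle × Torus τ)),
    S = ⋃ i, N i ∧ Pairwise (fun i j => Disjoint (N i) (N j)) ∧ ∀ i, IsCurve (N i)

theorem IsCurveUnion.isStratified {S : Set (Circle × Torus τ)} (hS : IsCurveUnion S) :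
    IsStratified S := by
  obtain ⟨ι, _, N, rfl, hd, hN⟩ := hS
  let e := Finite.equivFin ι
  refine ⟨Nat.card ι, N ∘ e.symm, (e.symm.surjective.iUnion_comp N).symm,
    fun i j hij => hd (e.symm.injective.ne hij), fun i => ?_⟩
  exact (hN _).elim (⟨0, ·⟩) (⟨1, ·⟩)

/-- The dimension bound needs a point, and the empty set is a submanifold of every dimension; empty
strata are therefore recast as discrete. -/
theorem IsStratified.isCurveUnion {S : Set (Circle × Torus τ)} (hS : IsStratified S)
    (hfib : ∀ x, {p | (x, p) ∈ S}.Countable) : IsCurveUnion S := by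
  obtain ⟨k, N, rfl, hd, hN⟩ := hS
  refine ⟨Fin k, inferInstance, N, rfl, hd, fun i => ?_⟩
  rcases (N i).eq_empty_or_nonempty with h | h
  · exact isCurve_of_isolated (by simp [h])
  · obtain ⟨d, hd⟩ := hN i
    have := hd.dim_le_one h fun x => (hfib x).mono fun p (hp : (x, p) ∈ N i) =>
      (Set.mem_iUnion.2 ⟨i, hp⟩ : (x, p) ∈ ⋃ i, N i)
    interval_cases d
    · exact .inl hd
    · exact .inr hd

theorem IsCurveUnion.disjoint_union {S S' : Set (Circle × Torus τ)} (hS : IsCurveUnion S)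
    (hS' : IsCurveUnion S') (h : Disjoint S S') : IsCurveUnion (S ∪ S') := by
  obtain ⟨ι, _, N, rfl, hd, hN⟩ := hS
  obtain ⟨ι', _, N', rfl, hd', hN'⟩ := hS'
  refine ⟨ι ⊕ ι', inferInstance, Sum.elim N N', by simp [Set.iUnion_sum], ?_, ?_⟩
  · have h' : ∀ i j, Disjoint (N i) (N' j) := fun i j =>
      h.mono (Set.subset_iUnion N i) (Set.subset_iUnion N' j)
    rintro (i | i) (j | j) hij
    · exact hd (by simpa using hij)
    · exact h' i j
    · exact (h' j i).symm
    · exact hd' (by simpa using hij)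
  · rintro (i | i)
    · exact hN i
    · exact hN' i

theorem IsCurve.isCurveUnion {N : Set (Circle × Torus τ)} (hN : IsCurve N) : IsCurveUnion N :=
  ⟨Unit, inferInstance, fun _ => N, (Set.iUnion_const N).symm, fun _ _ h => (h rfl).elim, fun _ => hN⟩

theorem isCurveUnion_iUnion {ι : Type} [Finite ι] {S : ι → Set (Circle × Torus τ)}
    (hS : ∀ i, IsCurveUnion (S i)) (h : Pairwise fun i j => Disjoint (S i) (S j)) :
    IsCurveUnion (⋃ i, S i) := by
  choose κ hκ N hN hd hc using hS
  refine ⟨Σ i, κ i, inferInstance, fun a => N a.1 a.2, ?_, ?_, fun a => hc _ _⟩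
  · simp only [Set.iUnion_sigma, ← hN]
  · rintro ⟨i, a⟩ ⟨j, b⟩ hab
    by_cases hij : i = j
    · subst hij
      exact hd i (by simpa using hab)
    · have : Disjoint (S i) (S j) := h hij
      rw [hN i, hN j] at this
      exact this.mono (Set.subset_iUnion _ a) (Set.subset_iUnion _ b)

/-- Each `P i` gets its own cut against `N`, and the overlap is assigned according to its side.
Since the `P i` are disjoint, a point of `N` competes with at most one of them. -/
theorem IsCurveUnion.union_curve {S N : Set (Circle × Torus τ)} (hS : IsCurveUnion S)
    (hN : IsCurve N) : IsCurveUnion (S ∪ N) := by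
  obtain ⟨ι, _, P, rfl, hd, hP⟩ := hS
  choose g c hg hcN hcP hgP hgN using fun i => hN.exists_cut (hP i)
  -- Overlaps on the level `g i = c i` itself go to `P i`.
  set N' : Set (Circle × Torus τ) := {x | x ∈ N ∧ ∀ i, x ∈ P i → c i < g i x} with N'_def
  set P' : ι → Set (Circle × Torus τ) := fun i => {x | x ∈ P i ∧ (c i < g i x → x ∉ N)} with P'_def
  have hU : (⋃ i, P i) ∪ N = (⋃ i, P' i) ∪ N' := by
    ext x
    simp only [Set.mem_union, Set.mem_iUnion, N'_def, P'_def, Set.mem_ofPred_eq]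
    constructor
    · rintro (⟨i, hi⟩ | hx)
      · by_cases h : c i < g i x ∧ x ∈ N
        · refine .inr ⟨h.2, fun j hj => ?_⟩
          obtain rfl : i = j := by
            by_contra hij
            exact Set.disjoint_left.1 (hd hij) hi hj
          exact h.1
        · exact .inl ⟨i, hi, fun h1 h2 => h ⟨h1, h2⟩⟩
      · by_cases h : ∀ i, x ∈ P i → c i < g i x
        · exact .inr ⟨hx, h⟩
        · push Not at h
          obtain ⟨i, hi, h⟩ := h
          exact .inl ⟨i, hi, fun h' => absurd h' (not_lt.2 h)⟩
    · rintro (⟨i, hi, _⟩ | hx)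
      · exact .inl ⟨i, hi⟩
      · exact .inr hx.1
  rw [hU]
  refine IsCurveUnion.disjoint_union (isCurveUnion_iUnion (fun i => ?_) ?_) ?_ ?_
  · have h1 : IsCurve {x | x ∈ P i ∧ g i x < c i} := (hP i).of_relOpen (fun x hx => hx.1)
      fun q hq => ((hg i q (.inr hq.1)).eventually_lt continuousAt_const hq.2).mono
        fun x hx hxP => ⟨hxP, hx⟩
    have h2 : IsCurve {x | x ∈ P i ∧ c i < g i x ∧ x ∉ N} := (hP i).of_relOpen (fun x hx => hx.1)
      fun q hq => by
        filter_upwards [continuousAt_const.eventually_lt (hg i q (.inr hq.1)) hq.2.1,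
          isClosed_closure.isOpen_compl.mem_nhds (hgP i q hq.1 hq.2.2 hq.2.1)] with x hx hx' hxP
        exact ⟨hxP, hx, fun h => hx' (subset_closure h)⟩
    have h3 : IsCurve {x | x ∈ P i ∧ g i x = c i} := isCurve_of_isolated fun q hq =>
      (hcP i q hq.1).mono fun x hx hxP => hx hxP.1 hxP.2
    have e : P' i = ({x | x ∈ P i ∧ g i x < c i} ∪ {x | x ∈ P i ∧ c i < g i x ∧ x ∉ N}) ∪
        {x | x ∈ P i ∧ g i x = c i} := by
      ext x
      simp only [P'_def, Set.mem_ofPred_eq, Set.mem_union]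
      rcases lt_trichotomy (g i x) (c i) with h | h | h
      · simp [h, h.ne, h.not_gt]
      · simp [h]
      · simp [h, h.ne', h.not_gt]
    rw [e]
    refine (h1.isCurveUnion.disjoint_union h2.isCurveUnion ?_).disjoint_union h3.isCurveUnion ?_
    · exact Set.disjoint_left.2 fun x hx hx' => lt_asymm hx.2 hx'.2.1
    · refine Set.disjoint_left.2 ?_
      rintro x (hx | hx) hx'
      · exact hx.2.ne hx'.2
      · exact hx.2.1.ne' hx'.2
  · exact fun i j hij => (hd hij).mono (fun x hx => hx.1) fun x hx => hx.1
  · have h1 : IsCurve {x | x ∈ N' ∧ ∀ i, g i x ≠ c i} := by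
      refine hN.of_relOpen (fun x hx => hx.1.1) fun q hq => ?_
      have hev : ∀ᶠ x in 𝓝 q, ∀ i, (x ∈ P i → c i < g i x) ∧ g i x ≠ c i := by
        refine Filter.eventually_all.2 fun i => ?_
        have hne := (hg i q (.inl hq.1.1)).eventually_ne (hq.2 i)
        rcases lt_or_gt_of_ne (hq.2 i) with h | h
        -- On the low side `N'` avoids `P i`, and by the cut even its closure, hence nearby points
        -- of `N` stay in `N'`.
        · have hqP : q ∉ P i := fun hqP => lt_asymm h (hq.1.2 i hqP)
          filter_upwards [hne, isClosed_closure.isOpen_compl.mem_nhds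
            (hgN i q hq.1.1 hqP h)] with x hx hx'
          exact ⟨fun hxP => absurd (subset_closure hxP) hx', hx⟩
        · filter_upwards [hne, continuousAt_const.eventually_lt (hg i q (.inl hq.1.1)) h]
            with x hx hx'
          exact ⟨fun _ => hx', hx⟩
      exact hev.mono fun x hx hxN => ⟨⟨hxN, fun i => (hx i).1⟩, fun i => (hx i).2⟩
    have h2 : IsCurve {x | x ∈ N' ∧ ∃ i, g i x = c i} := by
      refine isCurve_of_isolated fun q hq => ?_
      have hev : ∀ᶠ x in 𝓝 q, ∀ i, x ∈ N → g i x = c i → x = q :=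
        Filter.eventually_all.2 fun i => hcN i q hq.1.1
      filter_upwards [hev] with x hx hxN
      obtain ⟨i, hi⟩ := hxN.2
      exact hx i hxN.1.1 hi
    have e : N' = {x | x ∈ N' ∧ ∀ i, g i x ≠ c i} ∪ {x | x ∈ N' ∧ ∃ i, g i x = c i} := by
      ext x
      by_cases h : ∃ i, g i x = c i
      · simp [h]
      · simp [not_exists.1 h]
    rw [e]
    refine h1.isCurveUnion.disjoint_union h2.isCurveUnion ?_
    exact Set.disjoint_left.2 fun x hx ⟨_, i, hi⟩ => hx.2 i hi
  · rw [Set.disjoint_iUnion_left]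
    exact fun i => Set.disjoint_left.2 fun x hx hx' => hx.2 (hx'.2 i hx.1) hx'.1

/-- The curves of `S'` are added to `S` one at a time; their mutual disjointness plays no role. -/
theorem IsCurveUnion.union {S S' : Set (Circle × Torus τ)} (hS : IsCurveUnion S)
    (hS' : IsCurveUnion S') : IsCurveUnion (S ∪ S') := by
  obtain ⟨ι, _, N, rfl, -, hN⟩ := hS'
  have key : ∀ t : Set ι, IsCurveUnion (S ∪ ⋃ i ∈ t, N i) := fun t => by
    induction t, t.toFinite using Set.Finite.induction_on with
    | empty => simpa using hS
    | @insert a s _ _ ih =>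
      rw [Set.biUnion_insert, Set.union_left_comm, Set.union_comm]
      exact ih.union_curve (hN a)
  simpa using key Set.univ

/-! ### Direct sums of framed quotients -/

/-- Only finitely many factors of a finite-dimensional product are nontrivial. -/
theorem finite_setOf_nontrivial_of_finite_pi {K α : Type*} [Field K] {M : α → Type*}
    [∀ a, AddCommGroup (M a)] [∀ a, Module K (M a)] (h : Module.Finite K (∀ a, M a)) :
    {a | Nontrivial (M a)}.Finite := by
  classical
  have hne (a : {a | Nontrivial (M a)}) : ∃ e : M a, e ≠ 0 :=
    have : Nontrivial (M a) := a.2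
    exists_ne 0
  choose e he using hne
  have hli : LinearIndependent K fun a : {a | Nontrivial (M a)} =>
      (Pi.single a.1 (e a) : ∀ a, M a) := by
    refine linearIndependent_iff'.2 fun s c hc a ha => ?_
    have h1 := congrFun hc a.1
    rw [Finset.sum_apply, Finset.sum_eq_single a] at h1
    · simpa [he a] using h1
    · intro b _ hba
      simp [Pi.single_eq_of_ne (Subtype.coe_injective.ne hba.symm)]
    · exact fun h => absurd ha h
  have := hli.finite
  exact Set.toFinite _

namespace FramedQuot

section

variable {V₁ V₂ : Type*} [AddCommGroup V₁] [Module ℂ V₁] [AddCommGroup V₂] [Module ℂ V₂]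
  (Q₁ : FramedQuot τ V₁) (Q₂ : FramedQuot τ V₂)

/-- The map `𝒪_C ⊗ (V₁ ⊕ V₂) → F₁ ⊕ F₂` in the stalks at `p`. -/
def prodMk (p : Torus τ) : LocalRing p ⊗[ℂ] (V₁ × V₂) →ₗ[LocalRing p] Q₁.Stalk p × Q₂.Stalk p :=
  ((Q₁.ker p).mkQ.prodMap (Q₂.ker p).mkQ).comp
    (TensorProduct.prodRight ℂ (LocalRing p) (LocalRing p) V₁ V₂).toLinearMap

theorem prodMk_surjective (p : Torus τ) : Function.Surjective (prodMk Q₁ Q₂ p) :=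
  ((Q₁.ker p).mkQ_surjective.prodMap (Q₂.ker p).mkQ_surjective).comp (LinearEquiv.surjective _)

/-- The quotient by the kernel of `𝒪_C ⊗ (V₁ ⊕ V₂) → F₁ ⊕ F₂`. -/
def prodKerQuotEquiv (p : Torus τ) : ((LocalRing p ⊗[ℂ] (V₁ × V₂)) ⧸ (prodMk Q₁ Q₂ p).ker)
    ≃ₗ[LocalRing p] Q₁.Stalk p × Q₂.Stalk p :=
  (prodMk Q₁ Q₂ p).quotKerEquivOfSurjective (prodMk_surjective Q₁ Q₂ p)

theorem prodKerQuotEquiv_mkQ_tmul (p : Torus τ) (a : LocalRing p) (v : V₁ × V₂) :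
    prodKerQuotEquiv Q₁ Q₂ p ((prodMk Q₁ Q₂ p).ker.mkQ (a ⊗ₜ v)) =
      ((Q₁.ker p).mkQ (a ⊗ₜ v.1), (Q₂.ker p).mkQ (a ⊗ₜ v.2)) := rfl

/-- The direct sum of two framed quotients. -/
def prod : FramedQuot τ (V₁ × V₂) where
  ker p := (prodMk Q₁ Q₂ p).ker
  bijective := by
    have h : Function.Bijective fun (v : V₁ × V₂) (p : Torus τ) =>
        prodKerQuotEquiv Q₁ Q₂ p ((prodMk Q₁ Q₂ p).ker.mkQ (1 ⊗ₜ v)) := by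
      simp only [prodKerQuotEquiv_mkQ_tmul]
      constructor
      · intro v w h
        refine Prod.ext (Q₁.bijective.1 (funext fun p => ?_)) (Q₂.bijective.1 (funext fun p => ?_))
        · exact congrArg Prod.fst (congrFun h p)
        · exact congrArg Prod.snd (congrFun h p)
      · intro f
        obtain ⟨v, hv⟩ := Q₁.bijective.2 fun p => (f p).1
        obtain ⟨w, hw⟩ := Q₂.bijective.2 fun p => (f p).2
        exact ⟨(v, w), funext fun p => Prod.ext (congrFun hv p) (congrFun hw p)⟩
    constructor
    · intro v w hvw
      exact h.1 (funext fun p => congrArg (prodKerQuotEquiv Q₁ Q₂ p) (congrFun hvw p))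
    · intro f
      obtain ⟨v, hv⟩ := h.2 fun p => prodKerQuotEquiv Q₁ Q₂ p (f p)
      exact ⟨v, funext fun p => (prodKerQuotEquiv Q₁ Q₂ p).injective (congrFun hv p)⟩

/-- The stalk of the direct sum is the direct sum of the stalks. -/
def prodStalk (p : Torus τ) : (prod Q₁ Q₂).Stalk p ≃ₗ[LocalRing p] Q₁.Stalk p × Q₂.Stalk p :=
  prodKerQuotEquiv Q₁ Q₂ p

theorem prodStalk_mkQ_tmul (p : Torus τ) (a : LocalRing p) (v : V₁ × V₂) :
    prodStalk Q₁ Q₂ p (((prod Q₁ Q₂).ker p).mkQ (a ⊗ₜ v)) =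
      ((Q₁.ker p).mkQ (a ⊗ₜ v.1), (Q₂.ker p).mkQ (a ⊗ₜ v.2)) := rfl

theorem prodStalk_sum {ι : Type*} [Fintype ι] (p : Torus τ) (a : ι → LocalRing p)
    (v : ι → V₁ × V₂) :
    prodStalk Q₁ Q₂ p (∑ i, ((prod Q₁ Q₂).ker p).mkQ (a i ⊗ₜ v i)) =
      (∑ i, (Q₁.ker p).mkQ (a i ⊗ₜ (v i).1), ∑ i, (Q₂.ker p).mkQ (a i ⊗ₜ (v i).2)) := by
  rw [map_sum]
  simp only [prodStalk_mkQ_tmul]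
  exact Prod.ext Prod.fst_sum Prod.snd_sum

theorem prodStalk_frame (v : V₁ × V₂) (p : Torus τ) :
    prodStalk Q₁ Q₂ p ((prod Q₁ Q₂).frame v p) = (Q₁.frame v.1 p, Q₂.frame v.2 p) := rfl

theorem support_prod : (prod Q₁ Q₂).support = Q₁.support ∪ Q₂.support := by
  ext p
  change Nontrivial _ ↔ Nontrivial _ ∨ Nontrivial _
  rw [(prodStalk Q₁ Q₂ p).toEquiv.nontrivial_congr]
  simp only [← not_subsingleton_iff_nontrivial, ← not_and_or, not_iff_not]
  refine ⟨fun h => ⟨?_, ?_⟩, fun ⟨h, h'⟩ => inferInstance⟩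
  · exact (Prod.fst_surjective (β := Q₂.Stalk p)).subsingleton
  · exact (Prod.snd_surjective (α := Q₁.Stalk p)).subsingleton

theorem frame_act {V : Type*} [AddCommGroup V] [Module ℂ V] (Q : FramedQuot τ V)
    (U : Opens (Torus τ)) (h : Holo U) (v : V) (p : Torus τ) [Decidable (p ∈ U)] :
    Q.frame (Q.act U h v) p = if hp : p ∈ U then germ U p hp h • Q.frame v p else 0 := by
  rw [act, LinearEquiv.apply_symm_apply]
  congr

/-- The action is defined through the frame, so it is compared in the stalks, where the isomorphism
is `𝒪_{C,p}`-linear. Smoothness of the direct sum follows from this. -/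
theorem act_prod (U : Opens (Torus τ)) (h : Holo U) (v : V₁ × V₂) :
    (prod Q₁ Q₂).act U h v = (Q₁.act U h v.1, Q₂.act U h v.2) := by
  classical
  refine (prod Q₁ Q₂).frame.injective (funext fun p => (prodStalk Q₁ Q₂ p).injective ?_)
  rw [frame_act, prodStalk_frame _ _ (_, _), frame_act, frame_act]
  split_ifs with hp
  · rw [map_smul, prodStalk_frame]
    rfl
  · rw [map_zero]
    rfl

end

section Finite

variable {V : Type*} [AddCommGroup V] [Module ℂ V] [FiniteDimensional ℂ V] (Q : FramedQuot τ V)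

instance (p : Torus τ) : Module.Finite ℂ (Q.Stalk p) :=
  Module.Finite.of_surjective ((LinearMap.proj p).comp Q.frame.toLinearMap)
    ((Function.surjective_eval p).comp Q.frame.surjective)

/-- The product of all stalks is isomorphic to `V`, hence finite-dimensional. This is what bounds
the dimension of the strata. -/
theorem finite_support : Q.support.Finite :=
  finite_setOf_nontrivial_of_finite_pi (Module.Finite.equiv Q.frame)

end Finite

theorem length_prod {V₁ V₂ : Type*} [AddCommGroup V₁] [Module ℂ V₁] [AddCommGroup V₂] [Module ℂ V₂]
    [FiniteDimensional ℂ V₁] [FiniteDimensional ℂ V₂]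
    (Q₁ : FramedQuot τ V₁) (Q₂ : FramedQuot τ V₂) (p : Torus τ) :
    (prod Q₁ Q₂).length p = Q₁.length p + Q₂.length p := by
  rw [length, ((prodStalk Q₁ Q₂ p).restrictScalars ℂ).finrank_eq, Module.finrank_prod]
  rfl

end FramedQuot

/-! ### Direct sums of morphisms -/

section Prod

variable {F₁ : Type*} [NormedAddCommGroup F₁] [NormedSpace ℂ F₁]
  {F₂ : Type*} [NormedAddCommGroup F₂] [NormedSpace ℂ F₂]
  {E₁ : Circle → Type*} [TopologicalSpace (Bundle.TotalSpace F₁ E₁)]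
  [∀ x, TopologicalSpace (E₁ x)] [∀ x, AddCommGroup (E₁ x)] [FiberBundle F₁ E₁]
  {E₂ : Circle → Type*} [TopologicalSpace (Bundle.TotalSpace F₂ E₂)]
  [∀ x, TopologicalSpace (E₂ x)] [∀ x, AddCommGroup (E₂ x)] [FiberBundle F₂ E₂]

/-- A section of a direct sum is smooth if and only if its components are. -/
theorem smoothOn_prod_iff {s : ∀ x, (E₁ ×ᵇ E₂) x} {V : Set Circle} :
    SmoothOn (F₁ × F₂) (E₁ ×ᵇ E₂) s V ↔
      SmoothOn F₁ E₁ (fun x => (s x).1) V ∧ SmoothOn F₂ E₂ (fun x => (s x).2) V := by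
  simp only [SmoothOn, ContMDiffOn, ← forall_and]
  refine forall₂_congr fun x _ => ?_
  rw [Bundle.contMDiffWithinAt_section, Bundle.contMDiffWithinAt_section,
    Bundle.contMDiffWithinAt_section, contMDiffWithinAt_prod_module_iff]
  rfl

variable [∀ x, Module ℂ (E₁ x)] [∀ x, Module ℂ (E₂ x)]

/-- Smoothness over the circle is real, so linearity of the trivializations over `ℝ` is what enters.
-/
theorem smoothOn_zero [VectorBundle ℝ F₁ E₁] (V : Set Circle) :
    SmoothOn F₁ E₁ (fun _ => 0) V :=
  Bundle.contMDiffOn_zeroSection ℝ E₁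

theorem finiteDimensional_fibre [FiniteDimensional ℂ F₁] [VectorBundle ℂ F₁ E₁] (x : Circle) :
    FiniteDimensional ℂ (E₁ x) :=
  ((trivializationAt F₁ E₁ x).continuousLinearEquivAt ℂ x
    (FiberBundle.mem_baseSet_trivializationAt' x)).toLinearEquiv.symm.finiteDimensional

namespace AzMorphism

theorem isCurveUnion_support [FiniteDimensional ℂ F₁] [VectorBundle ℂ F₁ E₁]
    (φ : AzMorphism τ F₁ E₁) :
    IsCurveUnion {y : Circle × Torus τ | y.2 ∈ (φ.fib y.1).support} :=
  φ.stratified.isCurveUnion fun x =>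
    have := finiteDimensional_fibre (F₁ := F₁) (E₁ := E₁) x
    (φ.fib x).finite_support.countable

variable [FiniteDimensional ℂ F₁] [VectorBundle ℂ F₁ E₁] [FiniteDimensional ℂ F₂]
  [VectorBundle ℂ F₂ E₂] (φ₁ : AzMorphism τ F₁ E₁) (φ₂ : AzMorphism τ F₂ E₂)

/-- The direct sum of two morphisms. -/
def prod : AzMorphism τ (F₁ × F₂) (E₁ ×ᵇ E₂) where
  fib x := (φ₁.fib x).prod (φ₂.fib x)
  isOpen_support U := by
    simp only [FramedQuot.support_prod, Set.union_subset_iff]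
    exact (φ₁.isOpen_support U).inter (φ₂.isOpen_support U)
  smooth U h V hV hsupp s hs := by
    simp only [FramedQuot.support_prod, Set.union_subset_iff] at hsupp
    rw [smoothOn_prod_iff] at hs ⊢
    simp only [FramedQuot.act_prod]
    exact ⟨φ₁.smooth U h V hV (fun x hx => (hsupp x hx).1) _ hs.1,
      φ₂.smooth U h V hV (fun x hx => (hsupp x hx).2) _ hs.2⟩
  stratified := by
    have h := (φ₁.isCurveUnion_support.union φ₂.isCurveUnion_support).isStratified
    convert h using 1
    ext y
    simp only [FramedQuot.support_prod]
    rfl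

theorem mult_prod (x : Circle) (p : Torus τ) :
    (φ₁.prod φ₂).mult x p = φ₁.mult x p + φ₂.mult x p :=
  have := finiteDimensional_fibre (F₁ := F₁) (E₁ := E₁) x
  have := finiteDimensional_fibre (F₁ := F₂) (E₁ := E₂) x
  FramedQuot.length_prod _ _ p

/-- The two systems of sheets are put side by side: the counts over a point add, and so do the
integrals. -/
theorem isImageCycle_prod {T₁ T₂ : OneForm τ → ℝ} (h₁ : φ₁.IsImageCycle T₁)
    (h₂ : φ₂.IsImageCycle T₂) : (φ₁.prod φ₂).IsImageCycle (T₁ + T₂) := by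
  obtain ⟨ι₁, _, γ₁, ⟨hac₁, hc₁⟩, hT₁⟩ := h₁
  obtain ⟨ι₂, _, γ₂, ⟨hac₂, hc₂⟩, hT₂⟩ := h₂
  refine ⟨ι₁ ⊕ ι₂, inferInstance, Sum.elim γ₁ γ₂, ⟨Sum.forall.2 ⟨hac₁, hac₂⟩, ?_⟩, fun η => ?_⟩
  · intro t ht p
    rw [mult_prod, ← hc₁ t ht p, ← hc₂ t ht p, Nat.card_congr Equiv.subtypeSum, Nat.card_sum]
    rfl
  · simp [hT₁, hT₂, Fintype.sum_sum_type]

variable {φ₁ φ₂} {U : Opens (Torus τ)}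

theorem fst_mem_pushforward {σ : (φ₁.prod φ₂).Sec U} (hσ : σ ∈ (φ₁.prod φ₂).pushforward U) :
    (fun x p => ((φ₁.fib x).prodStalk (φ₂.fib x) p.1 (σ x p)).1 : φ₁.Sec U) ∈
      φ₁.pushforward U := by
  intro x p hp
  obtain ⟨V, W, hW, hV, hx, hpW, ι, _, h, s, hs, H⟩ := hσ x p hp
  refine ⟨V, W, hW, hV, hx, hpW, ι, inferInstance, h, fun i x => (s i x).1,
    fun i => (smoothOn_prod_iff.1 (hs i)).1, fun y hy q hq => ?_⟩
  exact congrArg Prod.fst ((congrArg _ (H y hy q hq)).trans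
    (FramedQuot.prodStalk_sum (φ₁.fib y) (φ₂.fib y) q _ fun i => s i y))

theorem snd_mem_pushforward {σ : (φ₁.prod φ₂).Sec U} (hσ : σ ∈ (φ₁.prod φ₂).pushforward U) :
    (fun x p => ((φ₁.fib x).prodStalk (φ₂.fib x) p.1 (σ x p)).2 : φ₂.Sec U) ∈
      φ₂.pushforward U := by
  intro x p hp
  obtain ⟨V, W, hW, hV, hx, hpW, ι, _, h, s, hs, H⟩ := hσ x p hp
  refine ⟨V, W, hW, hV, hx, hpW, ι, inferInstance, h, fun i x => (s i x).2,
    fun i => (smoothOn_prod_iff.1 (hs i)).2, fun y hy q hq => ?_⟩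
  exact congrArg Prod.snd ((congrArg _ (H y hy q hq)).trans
    (FramedQuot.prodStalk_sum (φ₁.fib y) (φ₂.fib y) q _ fun i => s i y))

variable [VectorBundle ℝ F₁ E₁] [VectorBundle ℝ F₂ E₂]

/-- On the common neighbourhood the two presentations are concatenated, each smooth section being
extended by zero in the other summand. -/
theorem prodStalk_symm_mem_pushforward {σ₁ : φ₁.Sec U} (h₁ : σ₁ ∈ φ₁.pushforward U)
    {σ₂ : φ₂.Sec U} (h₂ : σ₂ ∈ φ₂.pushforward U) :
    (fun x p => ((φ₁.fib x).prodStalk (φ₂.fib x) p.1).symm (σ₁ x p, σ₂ x p) :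
      (φ₁.prod φ₂).Sec U) ∈ (φ₁.prod φ₂).pushforward U := by
  intro x p hp
  obtain ⟨V, W, hW, hV, hx, hpW, ι, _, h, s, hs, H⟩ := h₁ x p hp
  obtain ⟨V', W', hW', hV', hx', hpW', ι', _, h', s', hs', H'⟩ := h₂ x p hp
  refine ⟨V ∩ V', W ⊓ W', inf_le_left.trans hW, hV.inter hV', ⟨hx, hx'⟩, ⟨hpW, hpW'⟩,
    ι ⊕ ι', inferInstance,
    Sum.elim (fun i => resHolo inf_le_left (h i)) (fun i => resHolo inf_le_right (h' i)),
    Sum.elim (fun i x => (s i x, 0)) (fun i x => (0, s' i x)), ?_, ?_⟩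
  · rintro (i | i)
    · exact smoothOn_prod_iff.2 ⟨(hs i).mono Set.inter_subset_left, smoothOn_zero _⟩
    · exact smoothOn_prod_iff.2 ⟨smoothOn_zero _, (hs' i).mono Set.inter_subset_right⟩
  · intro y hy q hq
    refine (LinearEquiv.symm_apply_eq _).2 (Eq.trans (Prod.ext ?_ ?_)
      (FramedQuot.prodStalk_sum (φ₁.fib y) (φ₂.fib y) q _ _).symm)
    · refine (H y hy.1 q hq.1).trans ?_
      simp [Fintype.sum_sum_type, germ_resHolo]
    · refine (H' y hy.2 q hq.2).trans ?_
      simp [Fintype.sum_sum_type, germ_resHolo]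

variable (φ₁ φ₂) in
/-- The push-forward of a direct sum is the direct sum of the push-forwards. -/
def pushforwardProd (U : Opens (Torus τ)) :
    (φ₁.prod φ₂).pushforward U ≃ₗ[Holo U] (φ₁.pushforward U × φ₂.pushforward U) where
  toFun σ := (⟨_, fst_mem_pushforward σ.2⟩, ⟨_, snd_mem_pushforward σ.2⟩)
  map_add' σ ρ := by
    refine Prod.ext (Subtype.ext ?_) (Subtype.ext ?_) <;> funext x p
    · exact congrArg Prod.fst (map_add ((φ₁.fib x).prodStalk (φ₂.fib x) p.1) (σ.1 x p) (ρ.1 x p))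
    · exact congrArg Prod.snd (map_add ((φ₁.fib x).prodStalk (φ₂.fib x) p.1) (σ.1 x p) (ρ.1 x p))
  map_smul' a σ := by
    refine Prod.ext (Subtype.ext ?_) (Subtype.ext ?_) <;> funext x p
    · exact congrArg Prod.fst (map_smul ((φ₁.fib x).prodStalk (φ₂.fib x) p.1)
        (germ U p.1 p.2 a) (σ.1 x p))
    · exact congrArg Prod.snd (map_smul ((φ₁.fib x).prodStalk (φ₂.fib x) p.1)
        (germ U p.1 p.2 a) (σ.1 x p))
  invFun ρ := ⟨_, prodStalk_symm_mem_pushforward ρ.1.2 ρ.2.2⟩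
  left_inv σ := Subtype.ext <| funext fun x => funext fun p =>
    ((φ₁.fib x).prodStalk (φ₂.fib x) p.1).symm_apply_apply (σ.1 x p)
  right_inv ρ := by
    refine Prod.ext (Subtype.ext ?_) (Subtype.ext ?_) <;> funext x p
    · exact congrArg Prod.fst (((φ₁.fib x).prodStalk (φ₂.fib x) p.1).apply_symm_apply
        (ρ.1.1 x p, ρ.2.1 x p))
    · exact congrArg Prod.snd (((φ₁.fib x).prodStalk (φ₂.fib x) p.1).apply_symm_apply
        (ρ.1.1 x p, ρ.2.1 x p))

end AzMorphism

end Prod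

end AzumayaCircle

end

theorem lemma4p3p2 (τ : UpperHalfPlane)
    -- a smooth complex vector bundle `E₁` over `S¹`
    {F₁ : Type*} [NormedAddCommGroup F₁] [NormedSpace ℂ F₁] [FiniteDimensional ℂ F₁]
    (E₁ : Circle → Type*) [TopologicalSpace (Bundle.TotalSpace F₁ E₁)]
    [∀ x, TopologicalSpace (E₁ x)] [∀ x, AddCommGroup (E₁ x)] [∀ x, Module ℂ (E₁ x)]
    [FiberBundle F₁ E₁] [VectorBundle ℂ F₁ E₁] [VectorBundle ℝ F₁ E₁]
    [ContMDiffVectorBundle ∞ F₁ E₁ (𝓡 1)]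
    -- a smooth complex vector bundle `E₂` over `S¹`
    {F₂ : Type*} [NormedAddCommGroup F₂] [NormedSpace ℂ F₂] [FiniteDimensional ℂ F₂]
    (E₂ : Circle → Type*) [TopologicalSpace (Bundle.TotalSpace F₂ E₂)]
    [∀ x, TopologicalSpace (E₂ x)] [∀ x, AddCommGroup (E₂ x)] [∀ x, Module ℂ (E₂ x)]
    [FiberBundle F₂ E₂] [VectorBundle ℂ F₂ E₂] [VectorBundle ℝ F₂ E₂]
    [ContMDiffVectorBundle ∞ F₂ E₂ (𝓡 1)]
    (φ₁ : AzumayaCircle.AzMorphism τ F₁ E₁) (φ₂ : AzumayaCircle.AzMorphism τ F₂ E₂) :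
    ∃ φ₃ : AzumayaCircle.AzMorphism τ (F₁ × F₂) (E₁ ×ᵇ E₂),
      -- the image cycle of `φ₃` is the sum of those of `φ₁` and `φ₂`,
      -- both before and after the projection `S¹ × C → C`
      (∀ x p, φ₃.mult x p = φ₁.mult x p + φ₂.mult x p) ∧
      (∀ T₁ T₂, φ₁.IsImageCycle T₁ → φ₂.IsImageCycle T₂ → φ₃.IsImageCycle (T₁ + T₂)) ∧
      -- the push-forward of `E₁ ⊕ E₂` is the direct sum of those of `E₁` and `E₂`
      AzumayaCircle.PushforwardIsoDirectSum φ₃ φ₁ φ₂ :=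

  ⟨φ₁.prod φ₂, φ₁.mult_prod φ₂, fun _ _ => φ₁.isImageCycle_prod φ₂, φ₁.pushforwardProd φ₂,
    -- The isomorphism acts point by point, so it commutes with restriction by definition.
    fun _ _ _ _ => rfl⟩
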